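/- Conventions. $\mathbb{R}_+=\{x\in\mathbb{R}: x>0\}$, $\mathbb{C}_+=\{x+iy: y>0\}$, $B_r(z)$ is the open disc of radius $r$ about $z$ (so $B_0(z)=\emptyset$). For an integer $s\ge 0$, the Cauchy wavelet $\psi$ of order $s$ is given by $\widehat\psi(\omega)=\omega^s e^{-2\pi\omega}\chi_{\omega>0}$, where $\widehat h(\omega)=\int h(t)e^{-2\pi i t\omega}\,dt$, and for $z=x+iy\in\mathbb{C}_+$ $$W_\psi f(z)=\frac{1}{|y|^{1/2}}\int_{\mathbb{R}} f(t)\,\overline{\psi\big((t-x)/y\big)}\,dt .$$ For $D\subset\mathbb{C}$ open, $D_0\subset D$ and $\Delta\ge\delta>0$ put $D_+=D\setminus\overline{D_0}$ and let $\mathcal{H}(D,D_0,\delta,\Delta)$ be the set of (atoll) functions $F\in C^1(D)$ with $|F|\le\Delta$ on $D$, $|\nabla|F||\le\Delta$ at all points of $D$ where $|F|$ is differentiable, and $|F|\ge\delta$ on $D_+$. The Sobolev norm is $\|h\|_{W^{1,2}(U)}=\|h\|_{L^2(U)}+\|\nabla h\|_{L^2(U)}$ with the weak gradient, and it is $+\infty$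 if $h\notin W^{1,2}(U)$. Theorem. There are a continuous function $\rho:[0,1)\to\mathbb{R}_+$ and a constant $c>0$, both uniform (that is, independent of all of the data below, including $s$ and $k$), such that the following holds. Let $s,k\ge 0$ be integers and, for $j=1,\dots,k$, let $z_j=x_j+iy_j$, $0\le r_j<s_j$ and $\Delta_j\ge\delta_j>0$ be such that $D_j:=B_{s_j}(z_j)\subset\mathbb{C}_+$; put $D_{0,j}:=B_{r_j}(z_j)$ and $(D_j)_+:=D_j\setminus\overline{D_{0,j}}$. Let $\psi$ be the Cauchy wavelet of order $s$, and let $f\in L^2(\mathbb{R})$ with $\operatorname{supp}\widehat f\subset\mathbb{R}_+$ (i.e. $\widehat f=0$ a.e. on $(-\infty,0]$) be such that $W_\psi f|_{D_j}\in\mathcal{H}(D_j,D_{0,j},\delta_j,\Delta_j)$ for all $j$. Then for every $g\in L^2(\mathbb{R})$ with $\operatorname{supp}\widehat g\subset\mathbb{R}_+$, $$\inf_{\alpha_1,\dots,\alpha_k\in\mathbb{R}}\sum_{j=1}^k\big\|W_\psi f-e^{i\alpha_j}W_\psi g\big\|_{L^2(D_j)}\le c\left(\sum_{j=1}^k\frac{\Delta_j^2}{\delta_j^2}\Big(1+\rho(\tfrac{r_j}{s_j})s_j\Big)\Big(1+r_j^{1/2}\rho(\tfrac{r_j}{s_j})\big(s_j^{1/2}+s_j^{-1/2}\big)\Big|\frac{1}{1-r_j/y_j}\Big|^{s+1/2}\Big)\right)\big\||W_\psi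 f|-|W_\psi g|\big\|_{W^{1,2}\left(\bigcup_{j=1}^k (D_j)_+\right)} .$$ Moreover, the lagoon factor grows only polynomially in the hyperbolic area $A=\int_{B_r(z)}\frac{dx\,dy}{y^2}$ of the lagoon: for every integer $s\ge0$ there is a constant $C>0$ such that, for all $z\in\mathbb{C}_+$ and $0\le r<\operatorname{Im} z$, $$\Big|\frac{1}{1-r/\operatorname{Im} z}\Big|^{s+1/2}\le C\,(1+A)^{2s+1}.$$ -/

import Mathlib

open MeasureTheory Set FourierTransform
open scoped ENNReal ContDiff ComplexConjugate

noncomputable section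

/-- The open upper half-plane `ℂ₊`. -/
def upperHalf : Set ℂ := {z | 0 < z.im}

/-- The Fourier transform `ξ ^ s * exp (-2 π ξ) * χ_{ξ > 0}` of the Cauchy wavelet of order `s`. -/
def cauchyWaveletHat (s : ℕ) (ξ : ℝ) : ℂ :=
  if 0 < ξ then ((ξ ^ s * Real.exp (-2 * Real.pi * ξ) : ℝ) : ℂ) else 0

/-- The Cauchy wavelet of order `s`: the inverse Fourier transform of the (integrable) function
`cauchyWaveletHat s`. -/
def cauchyWavelet (s : ℕ) : ℝ → ℂ := 𝓕⁻ (cauchyWaveletHat s)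

/-- The wavelet transform `W_ψ f (x, y) = |y|^{-1/2} ∫ f(t) conj (ψ ((t - x) / y)) dt`, written
as a function of `z = x + i y`. -/
def waveletTransform (ψ f : ℝ → ℂ) (z : ℂ) : ℂ :=
  ((1 / √|z.im| : ℝ) : ℂ) * ∫ t : ℝ, f t * conj (ψ ((t - z.re) / z.im))

/-- `f ∈ L²(ℝ)` is an analytic signal: its (Plancherel) Fourier transform is supported in
`ℝ₊ = {ξ | ξ > 0}`. -/
def IsAnalyticSignal (f : Lp ℂ 2 (volume : Measure ℝ)) : Prop :=
  ∀ᵐ ξ : ℝ, ξ ≤ 0 → (𝓕 f : Lp ℂ 2 (volume : Measure ℝ)) ξ = 0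

/-- The atoll domain `D₊ = D \ ⋃ i, closure (D₀ i)`. -/
def atollDomain {ι : Type*} (D : Set ℂ) (D₀ : ι → Set ℂ) : Set ℂ :=
  D \ ⋃ i, closure (D₀ i)

/-- The class `ℋ(D, (D₀ i)ᵢ, δ, Δ)` of atoll functions: `F ∈ C¹(D)`, `|F| ≤ Δ` and `|∇|F|| ≤ Δ`
on `D`, and `|F| ≥ δ` on `D₊`. The modulus `|F|` need not be differentiable at zeros of `F`;
the gradient bound is required wherever the gradient exists. The operator norm of the real
Fréchet derivative of `|F|` is the Euclidean norm of its gradient. -/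
structure IsAtollFunction {ι : Type*} (D : Set ℂ) (D₀ : ι → Set ℂ) (δ Δ : ℝ) (F : ℂ → ℂ) :
    Prop where
  contDiffOn : ContDiffOn ℝ 1 F D
  norm_le : ∀ z ∈ D, ‖F z‖ ≤ Δ
  grad_le : ∀ z ∈ D, DifferentiableAt ℝ (fun w => ‖F w‖) z →
    ‖fderiv ℝ (fun w => ‖F w‖) z‖ ≤ Δ
  le_norm : ∀ z ∈ atollDomain D D₀, δ ≤ ‖F z‖

/-- `v` is a weak gradient of the real function `h` on the open set `U ⊆ ℂ = ℝ²`; the vector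
`(v₁, v₂)` is written as `v₁ + i v₂`. -/
structure HasWeakGradient (U : Set ℂ) (h : ℂ → ℝ) (v : ℂ → ℂ) : Prop where
  locallyIntegrableOn : LocallyIntegrableOn h U volume
  locallyIntegrableOn_grad : LocallyIntegrableOn v U volume
  integral_eq : ∀ φ : ℂ → ℝ, ContDiff ℝ ∞ φ → HasCompactSupport φ → tsupport φ ⊆ U →
    ∀ e : ℂ, ∫ z in U, h z * fderiv ℝ φ z e = - ∫ z in U, inner ℝ (v z) e * φ z

/-- The Sobolev norm `‖h‖_{W^{1,2}(U)} = ‖h‖_{L²(U)} + ‖∇h‖_{L²(U)}`, equal to `∞` if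
`h ∉ W^{1,2}(U)`. A weak gradient is unique almost everywhere on `U`, so that the infimum is over
a single value if there is a weak gradient, and it is `∞` if there is none. -/
def sobolevNorm (U : Set ℂ) (h : ℂ → ℝ) : ℝ≥0∞ :=
  ⨅ (v : ℂ → ℂ) (_ : HasWeakGradient U h v),
    (eLpNorm h 2 (volume.restrict U) + eLpNorm v 2 (volume.restrict U))

/-- The area of `B ⊆ ℂ₊` in the Poincaré metric, `∫_B dx dy / y²`. -/
def hyperbolicArea (B : Set ℂ) : ℝ := ∫ z in B, 1 / z.im ^ 2

/-- The factor `|1 / (1 - r / y)| ^ (s + 1/2)` with which the disc of radius `r` about a point of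
imaginary part `y` enters the stability constant. -/
def lagoonFactor (s : ℕ) (r y : ℝ) : ℝ := |1 / (1 - r / y)| ^ ((s : ℝ) + 1 / 2)

end

/-! ### The Cauchy wavelet transform as a weighted holomorphic function -/

/-! The Cauchy wavelet is a constant times `(1 - it) ^ (-(s + 1))`, so `W_ψ f = y ^ (s + 1/2) K_f`
with `K_f` holomorphic on the upper half-plane (`waveletTransform_cauchyWavelet`). For two signals
the weight is the same, so that `h = W_ψ g / W_ψ f` is holomorphic on an annulus where `|W_ψ f| ≥
δ`.

On the annulus, write `F = W_ψ f`, `H = W_ψ g` and `u = |F| - |H| = |F| (1 - |h|)`. The modulus of a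
holomorphic function controls its derivative, `|h'| ≤ |∇|h||` where `h ≠ 0`, and the product rule
turns this into `|h'| ≤ Δ / δ² (|u| + |∇u|)` (`norm_deriv_div_le`). A Poincaré inequality
(`exists_lintegral_enorm_sub_sq_le`) makes `h` close in `L²` to a constant `m`, and the phase of `m`
aligns `H` with `F` (`norm_sub_exp_mul_le`). The Poincaré constant does not see the inner radius
because Cauchy's theorem gives `h` the same mean on all concentric circles.

In the lagoon there is no lower bound on `|F|`. However, `F - e^{iα} H` is again the weight times a
holomorphic function on the whole disc, and the square integral of such a function over the inner
disc is bounded by that over the annulus: mean squares over discs increase with the radius, and a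
holomorphic exponential factor replaces the weight by a constant
(`setLIntegral_weighted_closedBall_le_annulus`). This costs the lagoon factor, which is compared
with the hyperbolic area through a rectangle near the bottom of the disc (`hyperbolicArea_ball_ge`).
-/

theorem integrableOn_pow_mul_exp_neg_mul_Ioi (n : ℕ) {a : ℂ} (ha : 0 < a.re) :
    IntegrableOn (fun x : ℝ => (x : ℂ) ^ n * Complex.exp (-a * x)) (Ioi 0) := by
  have h := integrableOn_rpow_mul_exp_neg_mul_rpow (s := (n : ℝ)) (p := 1) (b := a.re)
    (by have : (0 : ℝ) ≤ n := n.cast_nonneg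
        linarith) one_pos ha
  refine Integrable.mono' h (by fun_prop) ?_
  refine (ae_restrict_iff' measurableSet_Ioi).2 (Filter.Eventually.of_forall fun x hx => ?_)
  have hx' : (0 : ℝ) < x := hx
  rw [norm_mul, norm_pow, Complex.norm_real, Complex.norm_exp, Real.norm_of_nonneg hx'.le,
    Real.rpow_natCast, Real.rpow_one]
  simp

theorem integral_pow_mul_exp_neg_mul_Ioi (n : ℕ) {a : ℂ} (ha : 0 < a.re) :
    ∫ x : ℝ in Ioi 0, (x : ℂ) ^ n * Complex.exp (-a * x) = n.factorial / a ^ (n + 1) := by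
  have ha0 : a ≠ 0 := fun h => by simp [h] at ha
  induction n with
  | zero =>
    have := integral_exp_mul_complex_Ioi (a := -a) (by simpa) 0
    simp only [pow_zero, one_mul, this]
    simp [neg_div_neg_eq]
  | succ n ih =>
    have hderiv : ∀ x ∈ Ioi (0 : ℝ), HasDerivAt
        (fun x : ℝ => (x : ℂ) ^ (n + 1) * Complex.exp (-a * x))
        (((n : ℂ) + 1) * ((x : ℂ) ^ n * Complex.exp (-a * x)) -
          a * ((x : ℂ) ^ (n + 1) * Complex.exp (-a * x))) x := by
      intro x _
      have h1 : HasDerivAt (fun x : ℝ => (x : ℂ)) 1 x := Complex.ofRealCLM.hasDerivAt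
      have h2 := (h1.pow (n + 1)).mul ((h1.const_mul (-a)).cexp)
      refine HasDerivAt.congr_deriv h2 ?_
      simp only [Pi.pow_apply]
      push_cast
      ring
    have hint := ((integrableOn_pow_mul_exp_neg_mul_Ioi n ha).const_mul ((n : ℂ) + 1)).sub
      ((integrableOn_pow_mul_exp_neg_mul_Ioi (n + 1) ha).const_mul a)
    have htend : Filter.Tendsto (fun x : ℝ => (x : ℂ) ^ (n + 1) * Complex.exp (-a * x))
        Filter.atTop (nhds 0) := by
      rw [tendsto_zero_iff_norm_tendsto_zero]
      have h := (Real.tendsto_pow_mul_exp_neg_atTop_nhds_zero (n + 1)).comp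
        (Filter.tendsto_id.const_mul_atTop ha)
      have h' := h.const_mul ((a.re ^ (n + 1))⁻¹)
      rw [mul_zero] at h'
      refine h'.congr' ?_
      filter_upwards [Filter.eventually_gt_atTop 0] with x hx
      rw [norm_mul, norm_pow, Complex.norm_real, Complex.norm_exp, Real.norm_of_nonneg hx.le]
      simp only [Function.comp, id, mul_pow]
      rw [← mul_assoc, ← mul_assoc, inv_mul_cancel₀ (by positivity), one_mul]
      simp
    have key := integral_Ioi_of_hasDerivAt_of_tendsto (a := (0 : ℝ)) (by
      apply Continuous.continuousWithinAt; fun_prop) hderiv hint htend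
    rw [integral_sub ((integrableOn_pow_mul_exp_neg_mul_Ioi n ha).const_mul _)
      ((integrableOn_pow_mul_exp_neg_mul_Ioi (n + 1) ha).const_mul a),
      integral_const_mul, integral_const_mul, ih] at key
    simp only [Complex.ofReal_zero, ne_eq, Nat.add_eq_zero_iff, one_ne_zero, and_false,
      not_false_eq_true, zero_pow, zero_mul, sub_zero] at key
    have h3 : a * ∫ x : ℝ in Ioi 0, (x : ℂ) ^ (n + 1) * Complex.exp (-a * x) =
        ((n : ℂ) + 1) * (n.factorial / a ^ (n + 1)) := (sub_eq_zero.1 key).symm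
    rw [Nat.factorial_succ, eq_div_iff (pow_ne_zero _ ha0), pow_succ a (n + 1),
      mul_comm (a ^ (n + 1)) a, ← mul_assoc, mul_comm _ a, h3]
    push_cast
    field_simp

theorem cauchyWavelet_eq (s : ℕ) (t : ℝ) :
    cauchyWavelet s t = s.factorial / (2 * Real.pi * (1 - t * Complex.I)) ^ (s + 1) := by
  have ha : 0 < (2 * Real.pi * (1 - t * Complex.I) : ℂ).re := by
    simp [Real.pi_pos]
  rw [← integral_pow_mul_exp_neg_mul_Ioi s ha, cauchyWavelet, Real.fourierInv_eq',
    ← integral_indicator measurableSet_Ioi]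
  congr 1 with x
  by_cases hx : 0 < x
  · simp only [cauchyWaveletHat, hx, if_true, indicator, mem_Ioi, smul_eq_mul,
      show inner ℝ x t = t * x from rfl]
    push_cast
    rw [mul_left_comm, ← Complex.exp_add]
    congr 2
    ring
  · simp [cauchyWaveletHat, hx, indicator]

/-- The holomorphic factor `∫ f(t) s! / (2 π i (t - z)) ^ (s + 1) dt` of the Cauchy wavelet
transform of order `s`. -/
noncomputable def cauchyTransform (s : ℕ) (f : ℝ → ℂ) (z : ℂ) : ℂ :=
  ∫ t : ℝ, f t * (s.factorial / (2 * Real.pi * Complex.I * (t - z)) ^ (s + 1))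

/-- Conjugation turns `1 - i(t - x)/y` into `1 + i(t - x)/y = i(t - z)/y`, which depends on `z`
holomorphically up to the factor `1/y`. The kernel contributes `y ^ (s + 1)` and the normalization
`y ^ (-1/2)`. -/
theorem waveletTransform_cauchyWavelet (s : ℕ) (f : ℝ → ℂ) {z : ℂ} (hz : 0 < z.im) :
    waveletTransform (cauchyWavelet s) f z =
      ((√z.im * z.im ^ s : ℝ) : ℂ) * cauchyTransform s f z := by
  have hy : (z.im : ℂ) ≠ 0 := by exact_mod_cast hz.ne'
  have hk : ∀ t : ℝ, conj (cauchyWavelet s ((t - z.re) / z.im)) =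
      (z.im : ℂ) ^ (s + 1) *
        (s.factorial / (2 * Real.pi * Complex.I * (t - z)) ^ (s + 1)) := by
    intro t
    have h1 : (2 * Real.pi * Complex.I * (t - z) : ℂ) =
        z.im * (2 * Real.pi * (1 + ((t - z.re) / z.im : ℝ) * Complex.I)) := by
      conv_lhs => rw [← Complex.re_add_im z]
      push_cast
      field_simp
      linear_combination (-(z.im : ℂ)) * Complex.I_sq
    have h2 : (1 + ((t - z.re) / z.im : ℝ) * Complex.I : ℂ) ≠ 0 := fun h => by
      have := congrArg Complex.re h
      simp at this
    rw [h1, cauchyWavelet_eq]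
    simp only [map_div₀, map_pow, map_mul, map_sub, map_one, Complex.conj_ofReal, Complex.conj_I,
      Complex.conj_natCast, map_ofNat]
    rw [mul_pow (z.im : ℂ), mul_div_assoc', mul_div_mul_left _ _ (pow_ne_zero _ hy)]
    congr 3
    ring
  have hs : √z.im ≠ 0 := (Real.sqrt_pos.2 hz).ne'
  have hw : (1 / √z.im) * z.im ^ (s + 1) = √z.im * z.im ^ s := by
    field_simp
    rw [pow_succ, Real.sq_sqrt hz.le]
    ring
  rw [waveletTransform, cauchyTransform, abs_of_pos hz, ← hw]
  simp_rw [hk, mul_left_comm _ ((z.im : ℂ) ^ (s + 1))]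
  rw [integral_const_mul]
  push_cast
  ring

theorem norm_ofReal_sub_ge {z : ℂ} (t : ℝ) : |z.im| ≤ ‖(t : ℂ) - z‖ := by
  simpa using Complex.abs_im_le_norm ((t : ℂ) - z)

theorem ofReal_sub_ne_zero {z : ℂ} (hz : 0 < z.im) (t : ℝ) : (t : ℂ) - z ≠ 0 := fun h => by
  have := norm_ofReal_sub_ge (z := z) t
  rw [h, norm_zero, abs_of_pos hz] at this
  linarith

theorem memLp_inv_ofReal_sub_pow (m : ℕ) {z : ℂ} (hz : 0 < z.im) :
    MemLp (fun t : ℝ => (((t : ℂ) - z) ^ (m + 1))⁻¹) 2 := by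
  have hcont : Continuous fun t : ℝ => (((t : ℂ) - z) ^ (m + 1))⁻¹ :=
    Continuous.inv₀ (by fun_prop) fun t => pow_ne_zero _ (ofReal_sub_ne_zero hz t)
  rw [memLp_two_iff_integrable_sq_norm hcont.aestronglyMeasurable]
  have hi : Integrable fun t : ℝ => (1 + ((t - z.re) / z.im) ^ 2)⁻¹ :=
    (integrable_inv_one_add_sq.comp_div hz.ne').comp_sub_right z.re
  refine Integrable.mono' (hi.const_mul ((z.im ^ (2 * (m + 1)))⁻¹)) (by fun_prop)
    (Filter.Eventually.of_forall fun t => ?_)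
  have h1 : ‖(t : ℂ) - z‖ ^ 2 = z.im ^ 2 * (1 + ((t - z.re) / z.im) ^ 2) := by
    rw [← Complex.normSq_eq_norm_sq, Complex.normSq_apply]
    simp
    field_simp
    ring
  have h2 : 1 ≤ 1 + ((t - z.re) / z.im) ^ 2 := by
    nlinarith [sq_nonneg ((t - z.re) / z.im)]
  rw [Real.norm_of_nonneg (by positivity), norm_inv, norm_pow, inv_pow, ← pow_mul, mul_comm,
    pow_mul, h1, mul_pow, ← pow_mul, ← mul_inv]
  gcongr
  exact le_self_pow₀ h2 (by omega)

theorem differentiableOn_cauchyTransform (s : ℕ) (f : Lp ℂ 2 (volume : Measure ℝ)) :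
    DifferentiableOn ℂ (cauchyTransform s f) upperHalf := by
  intro z hz
  have hz : 0 < z.im := hz
  apply DifferentiableAt.differentiableWithinAt
  have hf := Lp.memLp f
  set C : ℂ := s.factorial / (2 * Real.pi * Complex.I) ^ (s + 1) with hC
  have hker : ∀ w : ℂ, (fun t : ℝ => f t *
      (s.factorial / (2 * Real.pi * Complex.I * (t - w)) ^ (s + 1))) =
      fun t : ℝ => C * (f t * (((t : ℂ) - w) ^ (s + 1))⁻¹) := by
    intro w
    ext t
    rw [mul_pow, ← div_div, ← hC]
    ring
  have hint : ∀ (m : ℕ) (w : ℂ), 0 < w.im →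
      Integrable fun t : ℝ => f t * (((t : ℂ) - w) ^ (m + 1))⁻¹ := fun m w hw =>
    MemLp.integrable_mul hf (memLp_inv_ofReal_sub_pow m hw)
  have hball : ∀ w ∈ Metric.ball z (z.im / 2), 0 < w.im := by
    intro w hw
    have h1 : |(w - z).im| ≤ ‖w - z‖ := Complex.abs_im_le_norm _
    rw [Metric.mem_ball, dist_eq_norm] at hw
    rw [Complex.sub_im] at h1
    have := (abs_le.1 h1).1
    linarith
  have key := (hasDerivAt_integral_of_dominated_loc_of_deriv_le (μ := (volume : Measure ℝ))
    (F := fun w t => f t * (((t : ℂ) - w) ^ (s + 1))⁻¹)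
    (F' := fun w t => f t * ((s + 1) * (((t : ℂ) - w) ^ (s + 2))⁻¹))
    (bound := fun t => (s + 1) * 2 ^ (s + 2) * ‖f t * (((t : ℂ) - z) ^ (s + 1 + 1))⁻¹‖)
    (x₀ := z) (Metric.ball_mem_nhds z (half_pos hz)) ?_ (hint s z hz) ?_ ?_ ?_ ?_).2
  · have : cauchyTransform s f = fun w => C * ∫ t, f t * (((t : ℂ) - w) ^ (s + 1))⁻¹ := by
      ext w
      rw [cauchyTransform, hker, integral_const_mul]
    rw [this]
    exact (key.const_mul C).differentiableAt
  · filter_upwards [Metric.ball_mem_nhds z (half_pos hz)] with w hw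
    exact (hint s w (hball w hw)).aestronglyMeasurable
  · have := ((hint (s + 1) z hz).const_mul ((s : ℂ) + 1)).aestronglyMeasurable
    refine this.congr (Filter.Eventually.of_forall fun t => ?_)
    simp only
    ring
  · refine Filter.Eventually.of_forall fun t w hw => ?_
    have hw' := hball w hw
    -- Since `|w - z| < Im z / 2 ≤ |t - z| / 2`, the kernels at `w` are dominated by the kernel at
    -- `z`, uniformly in `t`.
    have h1 : ‖(t : ℂ) - z‖ ≤ 2 * ‖(t : ℂ) - w‖ := by
      have h2 := norm_ofReal_sub_ge (z := z) t
      rw [abs_of_pos hz] at h2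
      rw [Metric.mem_ball, dist_eq_norm] at hw
      have h3 : ‖(t : ℂ) - z‖ ≤ ‖(t : ℂ) - w‖ + ‖w - z‖ := by
        simpa using norm_add_le ((t : ℂ) - w) (w - z)
      linarith
    have hp : 0 < ‖(t : ℂ) - w‖ := norm_pos_iff.2 (ofReal_sub_ne_zero hw' t)
    have hq : 0 < ‖(t : ℂ) - z‖ := norm_pos_iff.2 (ofReal_sub_ne_zero hz t)
    have h4 : (‖(t : ℂ) - w‖ ^ (s + 2))⁻¹ ≤ 2 ^ (s + 2) * (‖(t : ℂ) - z‖ ^ (s + 2))⁻¹ := by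
      rw [← div_eq_mul_inv, le_div_iff₀ (by positivity), inv_mul_le_iff₀ (by positivity),
        ← mul_pow, mul_comm]
      gcongr
    have h5 : ‖((s : ℂ) + 1)‖ = s + 1 := by
      exact_mod_cast Complex.norm_natCast (s + 1)
    rw [norm_mul, norm_mul, norm_mul, h5, norm_inv, norm_pow, norm_inv, norm_pow]
    calc _ ≤ ‖f t‖ * ((s + 1) * (2 ^ (s + 2) * (‖(t : ℂ) - z‖ ^ (s + 2))⁻¹)) := by gcongr
      _ = _ := by ring
  · exact ((hint (s + 1) z hz).norm.const_mul _)
  · refine Filter.Eventually.of_forall fun t w hw => ?_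
    have h0 := ofReal_sub_ne_zero (hball w hw) t
    have h1 := ((((hasDerivAt_id w).const_sub (t : ℂ)).pow (s + 1)).inv
      (pow_ne_zero _ h0)).const_mul (f t)
    refine HasDerivAt.congr_deriv h1 ?_
    simp only [Pi.pow_apply, id]
    push_cast
    field_simp
    ring

/-! ### Square integrals of holomorphic functions over concentric discs -/

theorem measurePreserving_mul_left_of_norm_eq_one {w : ℂ} (hw : ‖w‖ = 1) :
    MeasurePreserving (fun z : ℂ => w * z) := by
  have := (rotation ⟨w, by simp [Submonoid.unitSphere, hw]⟩).measurePreserving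
  exact this

theorem setIntegral_closedBall_mul_left {w : ℂ} (hw : ‖w‖ = 1) (g : ℂ → ℝ) (ρ : ℝ) :
    ∫ z in Metric.closedBall 0 ρ, g (w * z) = ∫ z in Metric.closedBall 0 ρ, g z := by
  have hw0 : w ≠ 0 := fun h => by simp [h] at hw
  have h := (measurePreserving_mul_left_of_norm_eq_one hw).setIntegral_preimage_emb
    (measurableEmbedding_mulLeft₀ hw0) g (Metric.closedBall 0 ρ)
  rw [← h]
  congr 2
  ext z
  simp [hw]

theorem differentiableOn_integral_mul_conj {L : ℂ → ℂ} {M : ℂ → ℂ} {ρ R : ℝ} (hρ : 0 < ρ)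
    (hL : DifferentiableOn ℂ L (Metric.ball 0 R))
    (hM : ContinuousOn M (Metric.closedBall 0 ρ)) :
    DifferentiableOn ℂ (fun w => ∫ z in Metric.closedBall 0 ρ, L (w * z) * M z)
      (Metric.ball 0 (R / ρ)) := by
  intro w₀ hw₀
  apply DifferentiableAt.differentiableWithinAt
  rw [mem_ball_zero_iff] at hw₀
  -- For `|w| < σ` the points `w * z` stay in the compact disc of radius `σ ρ < R`, where `deriv L`
  -- is bounded.
  obtain ⟨σ, hσ, hσR⟩ := exists_between hw₀
  have hσ0 : 0 < σ := (norm_nonneg _).trans_lt hσ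
  have hsub : Metric.closedBall (0 : ℂ) (σ * ρ) ⊆ Metric.ball 0 R :=
    Metric.closedBall_subset_ball ((lt_div_iff₀ hρ).1 hσR)
  have hL' : DifferentiableOn ℂ (deriv L) (Metric.ball 0 R) := hL.deriv Metric.isOpen_ball
  obtain ⟨C, hC⟩ := (isCompact_closedBall (0 : ℂ) (σ * ρ)).exists_bound_of_continuousOn
    (hL'.continuousOn.mono hsub)
  obtain ⟨C', hC'⟩ := (isCompact_closedBall (0 : ℂ) ρ).exists_bound_of_continuousOn hM
  have hmaps : ∀ w ∈ Metric.ball (0 : ℂ) σ, MapsTo (fun z => w * z) (Metric.closedBall 0 ρ)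
      (Metric.closedBall 0 (σ * ρ)) := by
    intro w hw z hz
    rw [mem_ball_zero_iff] at hw
    rw [mem_closedBall_zero_iff] at hz ⊢
    rw [norm_mul]
    gcongr
  have hball : ∀ w ∈ Metric.ball (0 : ℂ) σ, ContinuousOn (fun z => L (w * z) * M z)
      (Metric.closedBall 0 ρ) := fun w hw =>
    (hL.continuousOn.comp (by fun_prop) fun z hz => hsub (hmaps w hw hz)).mul hM
  have hw₀σ : w₀ ∈ Metric.ball (0 : ℂ) σ := by simpa using hσ
  refine (hasDerivAt_integral_of_dominated_loc_of_deriv_le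
    (μ := (volume.restrict (Metric.closedBall (0 : ℂ) ρ)))
    (F := fun w z => L (w * z) * M z) (F' := fun w z => z * deriv L (w * z) * M z)
    (bound := fun _ => ρ * C * C') (x₀ := w₀) (Metric.isOpen_ball.mem_nhds hw₀σ)
    ?_ ?_ ?_ ?_ ?_ ?_).2.differentiableAt
  · filter_upwards [Metric.isOpen_ball.mem_nhds hw₀σ] with w hw
    exact (hball w hw).aestronglyMeasurable Metric.isClosed_closedBall.measurableSet
  · exact (hball w₀ hw₀σ).integrableOn_compact (isCompact_closedBall _ _)
  · refine ContinuousOn.aestronglyMeasurable ?_ Metric.isClosed_closedBall.measurableSet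
    exact (continuousOn_id.mul (hL'.continuousOn.comp (by fun_prop)
      fun z hz => hsub (hmaps w₀ hw₀σ hz))).mul hM
  · refine (ae_restrict_iff' Metric.isClosed_closedBall.measurableSet).2
      (Filter.Eventually.of_forall fun z hz w hw => ?_)
    have h1 := hC _ (hmaps w hw hz)
    have h2 := hC' z hz
    have h3 : 0 ≤ C := (norm_nonneg _).trans h1
    rw [mem_closedBall_zero_iff] at hz
    rw [norm_mul, norm_mul]
    gcongr
  · exact integrableOn_const (isCompact_closedBall _ _).measure_lt_top.ne
  · refine (ae_restrict_iff' Metric.isClosed_closedBall.measurableSet).2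
      (Filter.Eventually.of_forall fun z hz w hw => ?_)
    have h1 : HasDerivAt L (deriv L (w * z)) (w * z) :=
      (hL.differentiableAt (Metric.isOpen_ball.mem_nhds (hsub (hmaps w hw hz)))).hasDerivAt
    have h2 := (h1.comp w ((hasDerivAt_id w).mul_const z)).mul_const (M z)
    refine HasDerivAt.congr_deriv h2 ?_
    ring

/-- The mean square of a holomorphic function over a disc increases with the radius. -/
theorem integral_norm_sq_comp_mul_le {L : ℂ → ℂ} {ρ R a : ℝ} (hρ : 0 < ρ) (hρR : ρ < R)
    (ha : 0 < a) (ha1 : a ≤ 1) (hL : DifferentiableOn ℂ L (Metric.ball 0 R)) :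
    ∫ z in Metric.closedBall 0 ρ, ‖L (a * z)‖ ^ 2 ≤ ∫ z in Metric.closedBall 0 ρ, ‖L z‖ ^ 2 := by
  have hsub : Metric.closedBall (0 : ℂ) ρ ⊆ Metric.ball 0 R := Metric.closedBall_subset_ball hρR
  have hcont : ∀ w : ℂ, ‖w‖ ≤ 1 → ContinuousOn (fun z => L (w * z)) (Metric.closedBall 0 ρ) := by
    intro w hw
    refine hL.continuousOn.comp (by fun_prop) fun z hz => hsub ?_
    rw [mem_closedBall_zero_iff] at hz ⊢
    rw [norm_mul]
    nlinarith [norm_nonneg z, norm_nonneg w]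
  have ha' : ‖(a : ℂ)‖ ≤ 1 := by rwa [Complex.norm_real, Real.norm_of_nonneg ha.le]
  have hint : ∀ w : ℂ, ‖w‖ ≤ 1 → IntegrableOn (fun z => ‖L (w * z)‖ ^ 2)
      (Metric.closedBall 0 ρ) := fun w hw =>
    ((hcont w hw).norm.pow 2).integrableOn_compact (isCompact_closedBall _ _)
  have hM : ContinuousOn (fun z => conj (L (a * z))) (Metric.closedBall 0 ρ) :=
    Complex.continuous_conj.comp_continuousOn (hcont a ha')
  have hφ := differentiableOn_integral_mul_conj hρ hL hM
  -- Only one of the two factors varies with `w`, so `φ` is holomorphic, and the maximum principle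
  -- compares `φ a = A` with the values of `φ` on the unit circle.
  set φ : ℂ → ℂ := fun w => ∫ z in Metric.closedBall 0 ρ, L (w * z) * conj (L (a * z)) with hφdef
  set A := ∫ z in Metric.closedBall 0 ρ, ‖L (a * z)‖ ^ 2 with hA
  have hdc : DiffContOnCl ℂ φ (Metric.ball 0 1) := by
    refine hφ.diffContOnCl_ball (Metric.closedBall_subset_ball ?_)
    rwa [lt_div_iff₀ hρ, one_mul]
  have hval : φ a = A := by
    rw [hA, ← integral_complex_ofReal, hφdef]
    refine integral_congr_ae (Filter.Eventually.of_forall fun z => ?_)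
    simp only
    rw [Complex.mul_conj, Complex.normSq_eq_norm_sq]
  -- For `|w| = 1` this is `2xy ≤ x² + y²` and rotation invariance. The term `A / 2` is absorbed at
  -- the end.
  have hbd : ∀ w ∈ frontier (Metric.ball (0 : ℂ) 1), ‖φ w‖ ≤
      ((∫ z in Metric.closedBall 0 ρ, ‖L z‖ ^ 2) + A) / 2 := by
    intro w hw
    rw [frontier_ball _ one_ne_zero, mem_sphere_zero_iff_norm] at hw
    rw [← setIntegral_closedBall_mul_left hw (fun z => ‖L z‖ ^ 2) ρ, hA,
      ← integral_add (hint w hw.le) (hint a ha'), ← integral_div]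
    refine (norm_integral_le_integral_norm _).trans
      (integral_mono_of_nonneg (Filter.Eventually.of_forall fun z => norm_nonneg _)
      (((hint w hw.le).add (hint a ha')).div_const 2) (Filter.Eventually.of_forall fun z => ?_))
    simp only [norm_mul, RCLike.norm_conj]
    nlinarith [sq_nonneg (‖L (w * z)‖ - ‖L (a * z)‖)]
  have hmax := Complex.norm_le_of_forall_mem_frontier_norm_le Metric.isBounded_ball hdc hbd
    (z := (a : ℂ)) (by rw [closure_ball _ one_ne_zero]; simpa using ha')
  rw [hval, Complex.norm_real, Real.norm_of_nonneg (integral_nonneg fun z => by positivity)] at hmax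
  linarith

theorem setIntegral_norm_sq_closedBall_le {L : ℂ → ℂ} {ρ R a : ℝ} (hρ : 0 < ρ) (hρR : ρ < R)
    (ha : 0 < a) (ha1 : a ≤ 1) (hL : DifferentiableOn ℂ L (Metric.ball 0 R)) :
    ∫ z in Metric.closedBall 0 (a * ρ), ‖L z‖ ^ 2 ≤
      a ^ 2 * ∫ z in Metric.closedBall 0 ρ, ‖L z‖ ^ 2 := by
  have h := Measure.setIntegral_comp_smul_of_pos (volume : Measure ℂ) (fun z => ‖L z‖ ^ 2)
    (Metric.closedBall 0 ρ) ha
  rw [smul_closedBall _ _ hρ.le, smul_zero, Real.norm_of_nonneg ha.le,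
    Complex.finrank_real_complex] at h
  simp only [Complex.real_smul, smul_eq_mul] at h
  have h2 := integral_norm_sq_comp_mul_le hρ hρR ha ha1 hL
  rw [h, inv_mul_le_iff₀ (by positivity)] at h2
  exact h2

/-- The square integral of a holomorphic function over a disc is controlled by that over a
surrounding annulus. -/
theorem setIntegral_norm_sq_closedBall_le_annulus {L : ℂ → ℂ} {r R : ℝ} (hr : 0 < r) (hrR : r < R)
    (hL : DifferentiableOn ℂ L (Metric.ball 0 R)) :
    ∫ z in Metric.closedBall 0 r, ‖L z‖ ^ 2 ≤ r / R / (1 - r / R) *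
      ∫ z in Metric.closedBall 0 √(r * R) \ Metric.closedBall 0 r, ‖L z‖ ^ 2 := by
  have hR : 0 < R := hr.trans hrR
  have hτ : r / R < 1 := (div_lt_one hR).2 hrR
  have hρ : 0 < √(r * R) := Real.sqrt_pos.2 (by positivity)
  have hρR : √(r * R) < R := by
    rw [Real.sqrt_lt' hR]
    nlinarith
  have hrρ : r ≤ √(r * R) := Real.le_sqrt_of_sq_le (by nlinarith)
  have hrho : √(r / R) * √(r * R) = r := by
    rw [← Real.sqrt_mul (by positivity), show r / R * (r * R) = r ^ 2 by field_simp,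
      Real.sqrt_sq hr.le]
  -- The dilation by `√(r / R)` maps the disc of radius `√(r * R)` onto that of radius `r` and gains
  -- the factor `r / R < 1`, so the inner disc can be absorbed.
  have h := setIntegral_norm_sq_closedBall_le hρ hρR (Real.sqrt_pos.2 (div_pos hr hR))
    (Real.sqrt_le_one.2 hτ.le) hL
  rw [hrho, Real.sq_sqrt (by positivity)] at h
  have hint : IntegrableOn (fun z => ‖L z‖ ^ 2) (Metric.closedBall 0 √(r * R)) :=
    ((hL.continuousOn.mono (Metric.closedBall_subset_ball hρR)).norm.pow 2).integrableOn_compact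
      (isCompact_closedBall _ _)
  have hs := setIntegral_sdiff (Metric.isClosed_closedBall (x := (0 : ℂ)) (ε := r)).measurableSet
    hint (Metric.closedBall_subset_closedBall hrρ)
  have h1 : 0 < 1 - r / R := by linarith
  rw [hs, div_mul_eq_mul_div, le_div_iff₀ h1]
  linarith

theorem setLIntegral_comp_add_left (c : ℂ) (g : ℂ → ℝ≥0∞) (S : Set ℂ) :
    ∫⁻ z in (fun w => c + w) ⁻¹' S, g (c + z) = ∫⁻ z in S, g z :=
  (measurePreserving_add_left volume c).setLIntegral_comp_preimage_emb
    (measurableEmbedding_addLeft c) g S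

theorem preimage_add_left_closedBall (c : ℂ) (r : ℝ) :
    (fun w => c + w) ⁻¹' Metric.closedBall c r = Metric.closedBall 0 r := by
  ext z
  simp

/-- With `u = Im z / Im c` for `z` measured from `c`, the weight is `(Im c) ^ n (1 + u) ^ n`. The
function `e ^ (n u)` is the squared modulus of a holomorphic function and agrees with `(1 + u) ^ n`
to first order: `1 + u ≤ e ^ u ≤ (1 + u) / (1 - u²)`. The unweighted estimate only involves radii up
to `√(r * R)`, where `u² ≤ r R / (Im c)² ≤ r / Im c`. -/
theorem setLIntegral_weighted_closedBall_le_annulus {K : ℂ → ℂ} {c : ℂ} {r R : ℝ} (n : ℕ)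
    (hr : 0 < r) (hrR : r < R) (hRc : R ≤ c.im) (hK : DifferentiableOn ℂ K (Metric.ball c R)) :
    ∫⁻ z in Metric.closedBall c r, ENNReal.ofReal (z.im ^ n * ‖K z‖ ^ 2) ≤
      ENNReal.ofReal (r / R / (1 - r / R) * (1 / (1 - r / c.im)) ^ n) *
        ∫⁻ z in Metric.ball c R \ Metric.closedBall c r,
          ENNReal.ofReal (z.im ^ n * ‖K z‖ ^ 2) := by
  have hR : 0 < R := hr.trans hrR
  have hy : 0 < c.im := hR.trans_le hRc
  have hτ : 0 < 1 - r / R := by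
    have := (div_lt_one hR).2 hrR
    linarith
  have hτ' : 0 < 1 - r / c.im := by
    have := (div_lt_one hy).2 (hrR.trans_le hRc)
    linarith
  set ρ := √(r * R) with hρdef
  have hρR : ρ < R := by
    rw [hρdef, Real.sqrt_lt' hR]
    nlinarith
  have hrρ : r ≤ ρ := Real.le_sqrt_of_sq_le (by nlinarith)
  set L : ℂ → ℂ := fun z => K (c + z) * Complex.exp (-(Complex.I * n * z / (2 * c.im))) with hLdef
  have hL : DifferentiableOn ℂ L (Metric.ball 0 R) := by
    refine DifferentiableOn.mul (hK.comp (by fun_prop) fun z hz => ?_) (by fun_prop)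
    simpa using hz
  have hLnorm : ∀ z, ‖L z‖ ^ 2 = ‖K (c + z)‖ ^ 2 * Real.exp (z.im / c.im) ^ n := by
    intro z
    rw [hLdef]
    simp only
    rw [norm_mul, mul_pow, Complex.norm_exp, ← Real.exp_nat_mul, ← Real.exp_nat_mul]
    congr 2
    have : -(Complex.I * n * z / (2 * c.im)) = ((n / (2 * c.im) : ℝ) : ℂ) * (-(Complex.I * z)) := by
      push_cast
      ring
    rw [this, Complex.re_ofReal_mul]
    simp
    field_simp
  have him : ∀ z : ℂ, (c + z).im = c.im * (1 + z.im / c.im) := by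
    intro z
    rw [Complex.add_im]
    field_simp
  have hzim : ∀ z : ℂ, ‖z‖ ≤ ρ → |z.im / c.im| < 1 ∧ (z.im / c.im) ^ 2 ≤ r / c.im := by
    intro z hz
    have h1 : |z.im| ≤ ρ := (Complex.abs_im_le_norm z).trans hz
    constructor
    · rw [abs_div, abs_of_pos hy, div_lt_one hy]
      linarith
    · have h2 : z.im ^ 2 ≤ r * R := by
        rw [← sq_abs, ← Real.sq_sqrt (show 0 ≤ r * R by positivity)]
        gcongr
      rw [div_pow, div_le_div_iff₀ (by positivity) hy]
      nlinarith [mul_le_mul_of_nonneg_left hRc hr.le]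
  have hup : ∀ z ∈ Metric.closedBall (0 : ℂ) r,
      (c + z).im ^ n * ‖K (c + z)‖ ^ 2 ≤ c.im ^ n * ‖L z‖ ^ 2 := by
    intro z hz
    have h1 := (hzim z ((mem_closedBall_zero_iff.1 hz).trans hrρ)).1
    have h2 := (abs_lt.1 h1).1
    rw [hLnorm, mul_comm (‖K (c + z)‖ ^ 2), ← mul_assoc, ← mul_pow, him]
    gcongr
    · exact mul_nonneg hy.le (by linarith)
    · linarith [Real.add_one_le_exp (z.im / c.im)]
  have hlow : ∀ z ∈ Metric.closedBall (0 : ℂ) ρ, c.im ^ n * ‖L z‖ ^ 2 ≤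
      (1 / (1 - r / c.im)) ^ n * ((c + z).im ^ n * ‖K (c + z)‖ ^ 2) := by
    intro z hz
    obtain ⟨h1, h2⟩ := hzim z (mem_closedBall_zero_iff.1 hz)
    obtain ⟨h3, h4⟩ := abs_lt.1 h1
    set u := z.im / c.im
    have h5 : Real.exp u * (1 - u) ≤ 1 := by
      have h6 := Real.add_one_le_exp (-u)
      have h7 : Real.exp u * Real.exp (-u) = 1 := by rw [← Real.exp_add]; simp
      rw [← h7]
      gcongr
      linarith
    have h8 : Real.exp u ≤ 1 / (1 - r / c.im) * (1 + u) := by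
      rw [one_div, ← div_eq_inv_mul, le_div_iff₀ hτ']
      calc Real.exp u * (1 - r / c.im) ≤ Real.exp u * (1 - u ^ 2) := by gcongr
        _ = Real.exp u * (1 - u) * (1 + u) := by ring
        _ ≤ 1 * (1 + u) := by
          gcongr
          linarith
        _ = 1 + u := one_mul _
    rw [hLnorm, mul_comm (‖K (c + z)‖ ^ 2), ← mul_assoc, ← mul_assoc, ← mul_pow, ← mul_pow, him]
    refine mul_le_mul_of_nonneg_right (pow_le_pow_left₀ (by positivity) ?_ n) (by positivity)
    calc c.im * Real.exp u ≤ c.im * (1 / (1 - r / c.im) * (1 + u)) := by gcongr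
      _ = _ := by ring
  have hintL : IntegrableOn (fun z => ‖L z‖ ^ 2) (Metric.closedBall 0 ρ) :=
    ((hL.continuousOn.mono (Metric.closedBall_subset_ball hρR)).norm.pow 2).integrableOn_compact
      (isCompact_closedBall _ _)
  have hmr : MeasurableSet (Metric.closedBall (0 : ℂ) r) := Metric.isClosed_closedBall.measurableSet
  have hmd : MeasurableSet (Metric.closedBall (0 : ℂ) ρ \ Metric.closedBall 0 r) :=
    Metric.isClosed_closedBall.measurableSet.diff hmr
  have hA : (fun w => c + w) ⁻¹' (Metric.ball c R \ Metric.closedBall c r) =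
      Metric.ball 0 R \ Metric.closedBall 0 r := by
    ext z
    simp
  rw [← setLIntegral_comp_add_left c _ (Metric.closedBall c r), preimage_add_left_closedBall,
    ← setLIntegral_comp_add_left c _ (Metric.ball c R \ Metric.closedBall c r), hA]
  calc ∫⁻ z in Metric.closedBall 0 r, ENNReal.ofReal ((c + z).im ^ n * ‖K (c + z)‖ ^ 2)
      ≤ ∫⁻ z in Metric.closedBall 0 r, ENNReal.ofReal (c.im ^ n * ‖L z‖ ^ 2) :=
        setLIntegral_mono' hmr fun z hz => ENNReal.ofReal_le_ofReal (hup z hz)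
    _ = ENNReal.ofReal (c.im ^ n * ∫ z in Metric.closedBall 0 r, ‖L z‖ ^ 2) := by
        rw [← integral_const_mul, ofReal_integral_eq_lintegral_ofReal
          ((hintL.mono_set (Metric.closedBall_subset_closedBall hrρ)).const_mul _)
          (Filter.Eventually.of_forall fun z => by positivity)]
    _ ≤ ENNReal.ofReal (r / R / (1 - r / R) * ∫ z in
          Metric.closedBall 0 ρ \ Metric.closedBall 0 r, c.im ^ n * ‖L z‖ ^ 2) := by
        refine ENNReal.ofReal_le_ofReal ?_
        rw [integral_const_mul, mul_left_comm]
        gcongr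
        exact setIntegral_norm_sq_closedBall_le_annulus hr hrR hL
    _ = ENNReal.ofReal (r / R / (1 - r / R)) * ∫⁻ z in
          Metric.closedBall 0 ρ \ Metric.closedBall 0 r,
            ENNReal.ofReal (c.im ^ n * ‖L z‖ ^ 2) := by
        rw [ENNReal.ofReal_mul (by positivity), ofReal_integral_eq_lintegral_ofReal
          ((hintL.mono_set sdiff_subset).const_mul _)
          (Filter.Eventually.of_forall fun z => by positivity)]
    _ ≤ ENNReal.ofReal (r / R / (1 - r / R)) * ∫⁻ z in
          Metric.closedBall 0 ρ \ Metric.closedBall 0 r,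
            ENNReal.ofReal ((1 / (1 - r / c.im)) ^ n) *
              ENNReal.ofReal ((c + z).im ^ n * ‖K (c + z)‖ ^ 2) := by
        gcongr _ * ?_
        refine setLIntegral_mono' hmd fun z hz => ?_
        rw [← ENNReal.ofReal_mul (by positivity)]
        exact ENNReal.ofReal_le_ofReal (hlow z hz.1)
    _ ≤ _ := by
        rw [lintegral_const_mul' _ _ ENNReal.ofReal_ne_top, ← mul_assoc,
          ← ENNReal.ofReal_mul (by positivity)]
        gcongr
        exact Metric.closedBall_subset_ball hρR

/-! ### The Poincaré inequality for holomorphic functions on an annulus -/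

theorem lintegral_sq_le {α : Type*} {mα : MeasurableSpace α} (μ : Measure α) {k : α → ℝ≥0∞}
    (hk : AEMeasurable k μ) : (∫⁻ x, k x ∂μ) ^ 2 ≤ μ univ * ∫⁻ x, k x ^ 2 ∂μ := by
  have h := ENNReal.lintegral_mul_le_Lp_mul_Lq μ Real.HolderConjugate.two_two hk
    (aemeasurable_const (b := (1 : ℝ≥0∞)))
  simp only [Pi.mul_apply, mul_one, ENNReal.one_rpow, lintegral_const, one_mul] at h
  calc _ ≤ ((∫⁻ x, k x ^ (2 : ℝ) ∂μ) ^ (1 / 2 : ℝ) * μ univ ^ (1 / 2 : ℝ)) ^ 2 := by gcongr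
    _ = _ := by
      rw [mul_pow, ← ENNReal.rpow_natCast, ← ENNReal.rpow_natCast, ← ENNReal.rpow_mul,
        ← ENNReal.rpow_mul]
      norm_num
      rw [mul_comm]

/-- The circle average is the contour integral of `h z / (z - c)` up to a constant, so this is
Cauchy's theorem on the annulus. -/
theorem circleAverage_eq_of_differentiableOn_annulus {h : ℂ → ℂ} {c : ℂ} {r R ρ₁ ρ₂ : ℝ}
    (hr : 0 ≤ r) (hd : DifferentiableOn ℂ h (Metric.ball c R \ Metric.closedBall c r))
    (h1 : r < ρ₁) (h12 : ρ₁ ≤ ρ₂) (h2 : ρ₂ < R) :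
    Real.circleAverage h c ρ₁ = Real.circleAverage h c ρ₂ := by
  have h0 : 0 < ρ₁ := hr.trans_lt h1
  rw [Real.circleAverage_eq_circleIntegral h0.ne',
    Real.circleAverage_eq_circleIntegral (h0.trans_le h12).ne']
  congr 1
  refine (Complex.circleIntegral_sub_center_inv_smul_eq_of_differentiable_on_annulus_off_countable
    h0 h12 countable_empty ?_ ?_).symm
  · refine hd.continuousOn.mono ?_
    rintro z ⟨hz1, hz2⟩
    simp only [Metric.mem_closedBall, Metric.mem_ball, mem_sdiff, not_lt, not_le] at *
    constructor <;> linarith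
  · rintro z ⟨⟨hz1, hz2⟩, _⟩
    refine hd.differentiableAt ((Metric.isOpen_ball.sdiff Metric.isClosed_closedBall).mem_nhds ?_)
    simp only [Metric.mem_closedBall, Metric.mem_ball, mem_sdiff, not_le] at *
    constructor <;> linarith

/-- The rotation by the angle `θ` about the point `c`. -/
noncomputable def rotationAbout (c : ℂ) (θ : ℝ) (z : ℂ) : ℂ :=
  c + Complex.exp (θ * Complex.I) * (z - c)

theorem dist_rotationAbout (c : ℂ) (θ : ℝ) (z : ℂ) : dist (rotationAbout c θ z) c = dist z c := by
  simp [rotationAbout, dist_eq_norm, Complex.norm_exp_ofReal_mul_I]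

theorem continuous_rotationAbout (c : ℂ) : Continuous fun p : ℝ × ℂ => rotationAbout c p.1 p.2 := by
  unfold rotationAbout
  fun_prop

theorem measurePreserving_rotationAbout (c : ℂ) (θ : ℝ) :
    MeasurePreserving (rotationAbout c θ) := by
  have h := ((measurePreserving_add_left (volume : Measure ℂ) c).comp
    (measurePreserving_mul_left_of_norm_eq_one (Complex.norm_exp_ofReal_mul_I θ))).comp
    (measurePreserving_sub_right (volume : Measure ℂ) c)
  exact h

theorem rotationAbout_eq_circleMap (c : ℂ) (θ : ℝ) (z : ℂ) :
    rotationAbout c θ z = circleMap c ‖z - c‖ (θ + Complex.arg (z - c)) := by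
  rw [rotationAbout, circleMap]
  conv_lhs => rw [← Complex.norm_mul_exp_arg_mul_I (z - c)]
  push_cast
  rw [add_mul, Complex.exp_add]
  ring

theorem circleAverage_eq_integral_rotationAbout (h : ℂ → ℂ) (c z : ℂ) :
    Real.circleAverage h c ‖z - c‖ =
      (2 * Real.pi)⁻¹ • ∫ θ in (0 : ℝ)..2 * Real.pi, h (rotationAbout c θ z) := by
  rw [Real.circleAverage_eq_integral_add (Complex.arg (z - c))]
  simp_rw [rotationAbout_eq_circleMap]

/-- From `z` to any other point of its circle, `h` changes by at most the integral of `|h'|` along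
the whole circle; this is then averaged over the angle. -/
theorem norm_sub_circleAverage_le {h : ℂ → ℂ} {c : ℂ} {r R : ℝ}
    (hd : DifferentiableOn ℂ h (Metric.ball c R \ Metric.closedBall c r)) {z : ℂ}
    (hz : z ∈ Metric.ball c R \ Metric.closedBall c r) :
    ‖h z - Real.circleAverage h c ‖z - c‖‖ ≤
      ∫ θ in (0 : ℝ)..2 * Real.pi, ‖z - c‖ * ‖deriv h (rotationAbout c θ z)‖ := by
  have hA : IsOpen (Metric.ball c R \ Metric.closedBall c r) :=
    Metric.isOpen_ball.sdiff Metric.isClosed_closedBall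
  have hpi := Real.two_pi_pos
  have hmem : ∀ θ, rotationAbout c θ z ∈ Metric.ball c R \ Metric.closedBall c r := fun θ => by
    simpa [dist_rotationAbout] using hz
  have hrot : Continuous fun θ => rotationAbout c θ z :=
    (continuous_rotationAbout c).comp (by fun_prop : Continuous fun θ : ℝ => (θ, z))
  have hc : Continuous fun θ => h (rotationAbout c θ z) :=
    hd.continuousOn.comp_continuous hrot hmem
  have hc' : Continuous fun θ => deriv h (rotationAbout c θ z) :=
    (hd.deriv hA).continuousOn.comp_continuous hrot hmem
  have hderiv : ∀ θ : ℝ, HasDerivAt (fun θ : ℝ => h (rotationAbout c θ z))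
      (deriv h (rotationAbout c θ z) * (Complex.exp (θ * Complex.I) * Complex.I * (z - c))) θ := by
    intro θ
    have h1 : HasDerivAt (fun θ : ℝ => rotationAbout c θ z)
        (Complex.exp (θ * Complex.I) * Complex.I * (z - c)) θ := by
      have h2 : HasDerivAt (fun θ : ℝ => (θ : ℂ) * Complex.I) (1 * Complex.I) θ :=
        Complex.ofRealCLM.hasDerivAt.mul_const _
      have h3 := ((h2.cexp).mul_const (z - c)).const_add c
      exact h3.congr_deriv (by ring)
    have h4 := (hd.differentiableAt (hA.mem_nhds (hmem θ))).hasDerivAt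
    exact h4.comp_of_eq θ h1 rfl
  have hcd : Continuous fun θ : ℝ =>
      deriv h (rotationAbout c θ z) * (Complex.exp (θ * Complex.I) * Complex.I * (z - c)) :=
    hc'.mul (by fun_prop)
  have hnorm : ∀ θ : ℝ, ‖deriv h (rotationAbout c θ z) *
      (Complex.exp (θ * Complex.I) * Complex.I * (z - c))‖ =
      ‖z - c‖ * ‖deriv h (rotationAbout c θ z)‖ := by
    intro θ
    simp [mul_comm]
  set B := ∫ θ in (0 : ℝ)..2 * Real.pi, ‖z - c‖ * ‖deriv h (rotationAbout c θ z)‖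
  have hbd : ∀ θ ∈ uIoc (0 : ℝ) (2 * Real.pi), ‖h z - h (rotationAbout c θ z)‖ ≤ B := by
    intro θ hθ
    rw [uIoc_of_le hpi.le] at hθ
    have hftc := intervalIntegral.integral_eq_sub_of_hasDerivAt (a := 0) (b := θ)
      (fun x _ => hderiv x) (hcd.intervalIntegrable _ _)
    have h0 : rotationAbout c 0 z = z := by simp [rotationAbout]
    rw [h0] at hftc
    rw [norm_sub_rev, ← hftc]
    refine (intervalIntegral.norm_integral_le_integral_norm hθ.1.le).trans ?_
    simp_rw [hnorm]
    exact intervalIntegral.integral_mono_interval le_rfl hθ.1.le hθ.2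
      (Filter.Eventually.of_forall fun x => by positivity)
      ((continuous_const.mul hc'.norm).intervalIntegrable _ _)
  have hm : h z - Real.circleAverage h c ‖z - c‖ =
      (2 * Real.pi)⁻¹ • ∫ θ in (0 : ℝ)..2 * Real.pi, (h z - h (rotationAbout c θ z)) := by
    rw [circleAverage_eq_integral_rotationAbout, intervalIntegral.integral_sub
      (by simp) (hc.intervalIntegrable _ _), smul_sub, intervalIntegral.integral_const, sub_zero,
      smul_smul, inv_mul_cancel₀ hpi.ne', one_smul]
  rw [hm, norm_smul, Real.norm_of_nonneg (by positivity), inv_mul_le_iff₀ hpi]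
  have := intervalIntegral.norm_integral_le_of_norm_le_const hbd
  rwa [sub_zero, abs_of_pos hpi, mul_comm B] at this

theorem enorm_sub_circleAverage_sq_le {h : ℂ → ℂ} {c : ℂ} {r R : ℝ}
    (hd : DifferentiableOn ℂ h (Metric.ball c R \ Metric.closedBall c r)) {z : ℂ}
    (hz : z ∈ Metric.ball c R \ Metric.closedBall c r) :
    ‖h z - Real.circleAverage h c ‖z - c‖‖ₑ ^ 2 ≤ ENNReal.ofReal (2 * Real.pi * R ^ 2) *
      ∫⁻ θ in Ioc (0 : ℝ) (2 * Real.pi), ‖deriv h (rotationAbout c θ z)‖ₑ ^ 2 := by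
  have hA : IsOpen (Metric.ball c R \ Metric.closedBall c r) :=
    Metric.isOpen_ball.sdiff Metric.isClosed_closedBall
  have hpi := Real.two_pi_pos
  have hR : 0 ≤ R := by
    have := hz.1
    rw [Metric.mem_ball] at this
    exact dist_nonneg.trans this.le
  have hmem : ∀ θ, rotationAbout c θ z ∈ Metric.ball c R \ Metric.closedBall c r := fun θ => by
    simpa [dist_rotationAbout] using hz
  have hrot : Continuous fun θ => rotationAbout c θ z :=
    (continuous_rotationAbout c).comp (by fun_prop : Continuous fun θ : ℝ => (θ, z))
  have hc' : Continuous fun θ => deriv h (rotationAbout c θ z) :=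
    (hd.deriv hA).continuousOn.comp_continuous hrot hmem
  have h1 := norm_sub_circleAverage_le hd hz
  have hzc : ‖z - c‖ ≤ R := by
    have := hz.1
    rw [Metric.mem_ball, dist_eq_norm] at this
    exact this.le
  rw [intervalIntegral.integral_const_mul, intervalIntegral.integral_of_le hpi.le] at h1
  have h2 : ENNReal.ofReal (∫ θ in Ioc (0 : ℝ) (2 * Real.pi), ‖deriv h (rotationAbout c θ z)‖) =
      ∫⁻ θ in Ioc (0 : ℝ) (2 * Real.pi), ‖deriv h (rotationAbout c θ z)‖ₑ := by
    rw [ofReal_integral_norm_eq_lintegral_enorm]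
    exact hc'.continuousOn.integrableOn_Icc.mono_set Ioc_subset_Icc_self
  calc ‖h z - Real.circleAverage h c ‖z - c‖‖ₑ ^ 2
      ≤ (ENNReal.ofReal R * ∫⁻ θ in Ioc (0 : ℝ) (2 * Real.pi),
          ‖deriv h (rotationAbout c θ z)‖ₑ) ^ 2 := by
        rw [← h2, ← ENNReal.ofReal_mul hR, ← ofReal_norm]
        gcongr
        refine h1.trans ?_
        gcongr
    _ ≤ ENNReal.ofReal R ^ 2 * (ENNReal.ofReal (2 * Real.pi) *
          ∫⁻ θ in Ioc (0 : ℝ) (2 * Real.pi), ‖deriv h (rotationAbout c θ z)‖ₑ ^ 2) := by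
        rw [mul_pow]
        gcongr
        have := lintegral_sq_le (volume.restrict (Ioc (0 : ℝ) (2 * Real.pi)))
          (hc'.enorm.measurable.aemeasurable)
        simpa using this
    _ = _ := by
        rw [← mul_assoc, ← ENNReal.ofReal_pow hR, ← ENNReal.ofReal_mul (by positivity), mul_comm (R ^ 2)]

/-- The Poincaré inequality for a holomorphic function on an annulus, with a constant that does
not depend on the inner radius. -/
theorem exists_lintegral_enorm_sub_sq_le {h : ℂ → ℂ} {c : ℂ} {r R : ℝ} (hr : 0 ≤ r)
    (hd : DifferentiableOn ℂ h (Metric.ball c R \ Metric.closedBall c r)) :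
    ∃ m : ℂ, ∫⁻ z in Metric.ball c R \ Metric.closedBall c r, ‖h z - m‖ₑ ^ 2 ≤
      ENNReal.ofReal ((2 * Real.pi * R) ^ 2) *
        ∫⁻ z in Metric.ball c R \ Metric.closedBall c r, ‖deriv h z‖ₑ ^ 2 := by
  set A := Metric.ball c R \ Metric.closedBall c r with hAdef
  have hA : MeasurableSet A :=
    (Metric.isOpen_ball.sdiff Metric.isClosed_closedBall).measurableSet
  have hpi := Real.two_pi_pos
  -- Any radius strictly between `r` and `R` would give the same mean.
  refine ⟨Real.circleAverage h c ((r + R) / 2), ?_⟩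
  have hm : ∀ z ∈ A, Real.circleAverage h c ((r + R) / 2) = Real.circleAverage h c ‖z - c‖ := by
    rintro z ⟨hz1, hz2⟩
    rw [Metric.mem_ball, dist_eq_norm] at hz1
    rw [Metric.mem_closedBall, dist_eq_norm, not_le] at hz2
    rcases le_total ((r + R) / 2) ‖z - c‖ with hle | hle
    · exact circleAverage_eq_of_differentiableOn_annulus hr hd (by linarith) hle hz1
    · exact (circleAverage_eq_of_differentiableOn_annulus hr hd hz2 hle (by linarith)).symm
  -- Rotations preserve the annulus and the area, so after Fubini the integral over `θ` only
  -- contributes another factor `2π`.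
  have hrotint : ∀ θ : ℝ, ∫⁻ z in A, ‖deriv h (rotationAbout c θ z)‖ₑ ^ 2 =
      ∫⁻ z in A, ‖deriv h z‖ₑ ^ 2 := by
    intro θ
    have := (measurePreserving_rotationAbout c θ).setLIntegral_comp_preimage hA
      (f := fun z => ‖deriv h z‖ₑ ^ 2) ((measurable_deriv h).enorm.pow_const 2)
    rw [← this]
    congr 2
    ext z
    simp [hAdef, dist_rotationAbout]
  calc ∫⁻ z in A, ‖h z - Real.circleAverage h c ((r + R) / 2)‖ₑ ^ 2
      ≤ ∫⁻ z in A, ENNReal.ofReal (2 * Real.pi * R ^ 2) *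
          ∫⁻ θ in Ioc (0 : ℝ) (2 * Real.pi), ‖deriv h (rotationAbout c θ z)‖ₑ ^ 2 := by
        refine setLIntegral_mono' hA fun z hz => ?_
        rw [hm z hz]
        exact enorm_sub_circleAverage_sq_le hd hz
    _ = ENNReal.ofReal (2 * Real.pi * R ^ 2) * ∫⁻ θ in Ioc (0 : ℝ) (2 * Real.pi),
          ∫⁻ z in A, ‖deriv h (rotationAbout c θ z)‖ₑ ^ 2 := by
        rw [lintegral_const_mul' _ _ ENNReal.ofReal_ne_top, lintegral_lintegral_swap]
        refine Measurable.aemeasurable ?_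
        exact ((measurable_deriv h).comp ((continuous_rotationAbout c).measurable.comp
          measurable_swap)).enorm.pow_const 2
    _ = _ := by
        simp_rw [hrotint]
        rw [lintegral_const, Measure.restrict_apply_univ, Real.volume_Ioc, sub_zero, mul_comm (lintegral _ _),
          ← mul_assoc, ← ENNReal.ofReal_mul (by positivity)]
        congr 2
        ring

/-! ### Weak gradients of continuously differentiable functions -/

theorem MeasureTheory.LocallyIntegrableOn.integrable_mul_of_tsupport_subset {U : Set ℂ} {w φ : ℂ → ℝ}
    (hw : LocallyIntegrableOn w U) (hφ : Continuous φ) (hφc : HasCompactSupport φ)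
    (hφU : tsupport φ ⊆ U) : Integrable fun z => w z * φ z := by
  have h1 : IntegrableOn w (tsupport φ) := hw.integrableOn_compact_subset hφU hφc
  have h2 : IntegrableOn (fun z => w z * φ z) (tsupport φ) :=
    h1.mul_continuousOn hφ.continuousOn hφc
  refine (integrableOn_iff_integrable_of_support_subset ?_).1 h2
  intro z hz
  refine subset_tsupport φ ?_
  rw [Function.mem_support] at hz ⊢
  exact right_ne_zero_of_mul hz

/-- For test functions supported in `U'`, classical integration by parts and the weak identity have
the same left side; the fundamental lemma of the calculus of variations identifies the gradients. -/
theorem HasWeakGradient.ae_fderiv_apply_eq {U U' : Set ℂ} {u : ℂ → ℝ} {v : ℂ → ℂ}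
    (h : HasWeakGradient U u v) (hU' : IsOpen U') (hUU' : U' ⊆ U) (hu : ContDiffOn ℝ 1 u U')
    (e : ℂ) : ∀ᵐ z, z ∈ U' → fderiv ℝ u z e = inner ℝ (v z) e := by
  have hcont : ContinuousOn (fun z => fderiv ℝ u z e) U' :=
    (hu.continuousOn_fderiv_of_isOpen hU' le_rfl).clm_apply continuousOn_const
  have hl1 : LocallyIntegrableOn (fun z => fderiv ℝ u z e) U' :=
    hcont.locallyIntegrableOn hU'.measurableSet
  have hl2 : LocallyIntegrableOn (fun z => inner ℝ (v z) e) U' := by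
    intro z hz
    obtain ⟨t, ht, hint⟩ := h.locallyIntegrableOn_grad.mono_set hUU' z hz
    exact ⟨t, ht, hint.inner_const e⟩
  have hl3 : LocallyIntegrableOn u U' := h.locallyIntegrableOn.mono_set hUU'
  have key := hU'.ae_eq_zero_of_integral_contDiff_smul_eq_zero (hl1.sub hl2) ?_
  · filter_upwards [key] with z hz hzU
    exact sub_eq_zero.1 (hz hzU)
  intro φ hφ hφc hφU
  have hi1 := hl1.integrable_mul_of_tsupport_subset hφ.continuous hφc hφU
  have hi2 := hl2.integrable_mul_of_tsupport_subset hφ.continuous hφc hφU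
  have hi3 := hl3.integrable_mul_of_tsupport_subset hφ.continuous hφc hφU
  have hφ' : Continuous fun z => fderiv ℝ φ z e :=
    (hφ.continuous_fderiv (by simp)).clm_apply continuous_const
  have hsub : tsupport (fun z => fderiv ℝ φ z e) ⊆ tsupport φ := tsupport_fderiv_apply_subset ℝ e
  have hi4 := hl3.integrable_mul_of_tsupport_subset hφ' (hφc.of_isClosed_subset
    (isClosed_tsupport _) hsub) (hsub.trans hφU)
  have hparts := integral_mul_fderiv_eq_neg_fderiv_mul_of_integrable hi1 hi4 hi3
    (fun x hx => (hu.contDiffAt (hU'.mem_nhds (hφU hx))).differentiableAt (by simp))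
    (fun x _ => hφ.contDiffAt.differentiableAt (by simp))
  have hweak := h.integral_eq φ hφ hφc (hφU.trans hUU') e
  have hzero : ∀ x, x ∉ U → φ x = 0 := fun x hx =>
    image_eq_zero_of_notMem_tsupport fun hx' => hx (hUU' (hφU hx'))
  have hzero' : ∀ x, x ∉ U → fderiv ℝ φ x e = 0 := fun x hx =>
    image_eq_zero_of_notMem_tsupport (f := fun z => fderiv ℝ φ z e)
      fun hx' => hx (hUU' (hφU (hsub hx')))
  rw [setIntegral_eq_integral_of_forall_compl_eq_zero fun x hx => by simp [hzero' x hx],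
    setIntegral_eq_integral_of_forall_compl_eq_zero fun x hx => by simp [hzero x hx],
    hparts, neg_inj] at hweak
  simp only [Pi.sub_apply, smul_eq_mul, mul_sub]
  simp_rw [mul_comm (φ _)]
  rw [integral_sub hi1 hi2, hweak, sub_self]

theorem HasWeakGradient.ae_norm_fderiv_le {U U' : Set ℂ} {u : ℂ → ℝ} {v : ℂ → ℂ}
    (h : HasWeakGradient U u v) (hU' : IsOpen U') (hUU' : U' ⊆ U) (hu : ContDiffOn ℝ 1 u U') :
    ∀ᵐ z, z ∈ U' → ‖fderiv ℝ u z‖ ≤ ‖v z‖ := by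
  filter_upwards [h.ae_fderiv_apply_eq hU' hUU' hu 1,
    h.ae_fderiv_apply_eq hU' hUU' hu Complex.I] with z h1 h2 hz
  refine ContinuousLinearMap.opNorm_le_bound _ (norm_nonneg _) fun w => ?_
  have hw : fderiv ℝ u z w = inner ℝ (v z) w := by
    have : w = w.re • (1 : ℂ) + w.im • Complex.I := by simp
    rw [this, map_add, map_smul, map_smul, h1 hz, h2 hz, inner_add_right, inner_smul_right,
      inner_smul_right, smul_eq_mul, smul_eq_mul]
  rw [hw]
  exact norm_inner_le_norm _ _

/-! ### The modulus of a holomorphic function -/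

/-- In the direction `e = h / h'` the differential of `h` is `h` itself, so `|h|` grows at rate
`|h|`, while `|e| = |h| / |h'|`. -/
theorem norm_deriv_le_norm_fderiv_norm {h : ℂ → ℂ} {z : ℂ} (hd : DifferentiableAt ℂ h z)
    (h0 : h z ≠ 0) : ‖deriv h z‖ ≤ ‖fderiv ℝ (fun w => ‖h w‖) z‖ := by
  rcases eq_or_ne (deriv h z) 0 with hz | hz
  · simp [hz]
  have hdR : HasFDerivAt h ((fderiv ℂ h z).restrictScalars ℝ) z :=
    hd.hasFDerivAt.restrictScalars ℝ
  have hnorm : DifferentiableAt ℝ (fun w => ‖h w‖) z := hdR.differentiableAt.norm ℝ h0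
  set e : ℂ := h z / deriv h z with he
  have hsq : HasFDerivAt (fun w => ‖h w‖ ^ 2) _ z := hdR.norm_sq
  have hsq' : HasFDerivAt (fun w => ‖h w‖ ^ 2) _ z := hnorm.hasFDerivAt.pow 2
  have heq := congrArg (fun T : ℂ →L[ℝ] ℝ => T e) (hsq.unique hsq')
  have hfd : fderiv ℂ h z e = h z := by
    rw [← fderiv_apply_one_eq_deriv] at hz he
    have : e = e • (1 : ℂ) := by simp
    rw [this, map_smul, smul_eq_mul, he, div_mul_cancel₀ _ hz]
  simp [hfd] at heq
  have hpos : 0 < ‖h z‖ := norm_pos_iff.2 h0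
  have hval : fderiv ℝ (fun w => ‖h w‖) z e = ‖h z‖ := by
    have h2 : 2 * ‖h z‖ * (fderiv ℝ (fun w => ‖h w‖) z e) = 2 * ‖h z‖ * ‖h z‖ := by
      rw [← heq]
      ring
    exact mul_left_cancel₀ (by positivity) h2
  have hle := (fderiv ℝ (fun w => ‖h w‖) z).le_opNorm e
  rw [hval, Real.norm_of_nonneg hpos.le, he, norm_div, mul_div_assoc', le_div_iff₀ (norm_pos_iff.2 hz),
    mul_comm] at hle
  exact le_of_mul_le_mul_right hle hpos

/-- Zeros with nonzero derivative are isolated, hence countable in number. No connectedness is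
needed, and `h` may vanish identically. -/
theorem ae_deriv_eq_zero_of_eq_zero {h : ℂ → ℂ} {U : Set ℂ} (hU : IsOpen U)
    (hd : DifferentiableOn ℂ h U) : ∀ᵐ z, z ∈ U → h z = 0 → deriv h z = 0 := by
  set S : Set ℂ := {z | z ∈ U ∧ h z = 0 ∧ deriv h z ≠ 0} with hS
  have hdisc : IsDiscrete S := by
    refine IsDiscrete.of_nhdsWithin fun z hz => ?_
    have h1 := (hd.differentiableAt (hU.mem_nhds hz.1)).hasDerivAt.eventually_ne (c := 0) hz.2.2
    rw [Filter.le_pure_iff, mem_nhdsWithin_iff_eventually]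
    rw [eventually_nhdsWithin_iff] at h1
    filter_upwards [h1] with w hw hwS
    by_contra hne
    exact hw hne hwS.2.1
  have hcount : S.Countable :=
    (HereditarilyLindelofSpace.isLindelof S).countable_of_isDiscrete hdisc
  filter_upwards [compl_mem_ae_iff.2 (hcount.measure_zero volume)] with z hz hzU h0
  by_contra h1
  exact hz ⟨hzU, h0, h1⟩

/-! ### The stability estimate on one atoll -/

theorem eLpNorm_two_sq {α E : Type*} {mα : MeasurableSpace α} [NormedAddCommGroup E] (f : α → E)
    (μ : Measure α) : eLpNorm f 2 μ ^ 2 = ∫⁻ x, ‖f x‖ₑ ^ 2 ∂μ := by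
  have h := eLpNorm_nnreal_pow_eq_lintegral (f := f) (μ := μ) (p := 2) two_ne_zero
  simp only [NNReal.coe_ofNat, ENNReal.coe_ofNat, ENNReal.rpow_ofNat] at h
  exact h

theorem eLpNorm_two_le_of_lintegral_sq_le {α β E F : Type*} {mα : MeasurableSpace α}
    {mβ : MeasurableSpace β} [NormedAddCommGroup E] [NormedAddCommGroup F] {f : α → E} {g : β → F}
    {μ : Measure α} {ν : Measure β} {C : ℝ} (hC : 0 ≤ C)
    (h : ∫⁻ x, ‖f x‖ₑ ^ 2 ∂μ ≤ ENNReal.ofReal (C ^ 2) * ∫⁻ x, ‖g x‖ₑ ^ 2 ∂ν) :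
    eLpNorm f 2 μ ≤ ENNReal.ofReal C * eLpNorm g 2 ν := by
  rw [← eLpNorm_two_sq, ← eLpNorm_two_sq, ENNReal.ofReal_pow hC, ← mul_pow] at h
  exact (ENNReal.pow_le_pow_left_iff two_ne_zero).1 h

theorem eLpNorm_two_restrict_union_le {α E : Type*} {mα : MeasurableSpace α}
    [NormedAddCommGroup E] (f : α → E) (μ : Measure α) (S T : Set α) :
    eLpNorm f 2 (μ.restrict (S ∪ T)) ≤
      eLpNorm f 2 (μ.restrict S) + eLpNorm f 2 (μ.restrict T) := by
  rw [← ENNReal.pow_le_pow_left_iff two_ne_zero, eLpNorm_two_sq, add_sq, eLpNorm_two_sq,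
    eLpNorm_two_sq]
  calc _ ≤ _ := lintegral_union_le _ S T
    _ ≤ _ := by
      gcongr
      exact le_self_add

/-- The product rule gives `N ∇|h| = (1 - |h|) ∇N - ∇u`, and `|1 - |h|| = |u| / N ≤ |u| / δ`. In the
application, `N = |F|`. -/
theorem norm_deriv_div_le {N u : ℂ → ℝ} {h : ℂ → ℂ} {z : ℂ} {δ Δ : ℝ} (hδ : 0 < δ)
    (hd : DifferentiableAt ℂ h z) (h0 : h z ≠ 0) (hN : DifferentiableAt ℝ N z)
    (hu : u =ᶠ[nhds z] fun w => N w * (1 - ‖h w‖)) (hNδ : δ ≤ N z) (hδΔ : δ ≤ Δ)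
    (hN' : ‖fderiv ℝ N z‖ ≤ Δ) :
    ‖deriv h z‖ ≤ Δ / δ ^ 2 * (|u z| + ‖fderiv ℝ u z‖) := by
  have hnorm : DifferentiableAt ℝ (fun w => ‖h w‖) z := (hd.restrictScalars ℝ).norm ℝ h0
  have hΔ : 0 < Δ := hδ.trans_le hδΔ
  have hNz : 0 < N z := hδ.trans_le hNδ
  have h1 : HasFDerivAt u (N z • (-fderiv ℝ (fun w => ‖h w‖) z) + (1 - ‖h z‖) • fderiv ℝ N z) z :=
    (hN.hasFDerivAt.mul (hnorm.hasFDerivAt.const_sub 1)).congr_of_eventuallyEq hu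
  have h2 : N z • fderiv ℝ (fun w => ‖h w‖) z = (1 - ‖h z‖) • fderiv ℝ N z - fderiv ℝ u z := by
    rw [h1.fderiv]
    simp
  have h3 : N z * ‖fderiv ℝ (fun w => ‖h w‖) z‖ ≤ |1 - ‖h z‖| * Δ + ‖fderiv ℝ u z‖ := by
    calc _ = ‖N z • fderiv ℝ (fun w => ‖h w‖) z‖ := by
          rw [norm_smul, Real.norm_of_nonneg hNz.le]
      _ ≤ ‖(1 - ‖h z‖) • fderiv ℝ N z‖ + ‖fderiv ℝ u z‖ := by
          rw [h2]
          exact norm_sub_le _ _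
      _ ≤ _ := by
          rw [norm_smul, Real.norm_eq_abs]
          gcongr
  have h4 : |u z| = N z * |1 - ‖h z‖| := by
    rw [hu.eq_of_nhds, abs_mul, abs_of_pos hNz]
  have h5 : |1 - ‖h z‖| * δ ≤ |u z| := by
    rw [h4, mul_comm]
    gcongr
  refine (norm_deriv_le_norm_fderiv_norm hd h0).trans ?_
  set T := ‖fderiv ℝ (fun w => ‖h w‖) z‖
  have hT : 0 ≤ T := norm_nonneg _
  have h6 : δ * T ≤ |1 - ‖h z‖| * Δ + ‖fderiv ℝ u z‖ := le_trans (by gcongr) h3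
  rw [div_mul_eq_mul_div, le_div_iff₀ (by positivity)]
  calc T * δ ^ 2 = δ * (δ * T) := by ring
    _ ≤ δ * (|1 - ‖h z‖| * Δ + ‖fderiv ℝ u z‖) := by gcongr
    _ = Δ * (|1 - ‖h z‖| * δ) + δ * ‖fderiv ℝ u z‖ := by ring
    _ ≤ Δ * |u z| + Δ * ‖fderiv ℝ u z‖ := by gcongr
    _ = _ := by ring

/-- With `E = m / |m|`, the distance from `E` to `h` is at most `||m| - 1| + |m - h|`, and `|m|`
differs from `|h|` by at most `|m - h|`; hence the factor 2. For `m = 0` the convention `arg 0 = 0`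
gives `E = 1`, and the argument still holds. -/
theorem norm_sub_exp_mul_le (F h m : ℂ) : ‖F - Complex.exp (Complex.I * (-Complex.arg m : ℝ)) *
    (h * F)‖ ≤ 2 * ‖F‖ * ‖h - m‖ + |‖F‖ * (1 - ‖h‖)| := by
  set E := Complex.exp (Complex.arg m * Complex.I) with hE
  have hEn : ‖E‖ = 1 := Complex.norm_exp_ofReal_mul_I _
  have h1 : Complex.exp (Complex.I * (-Complex.arg m : ℝ)) * E = 1 := by
    rw [hE, ← Complex.exp_add]
    push_cast
    rw [show Complex.I * -(Complex.arg m : ℂ) + Complex.arg m * Complex.I = 0 by ring,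
      Complex.exp_zero]
  have h2 : ‖Complex.exp (Complex.I * (-Complex.arg m : ℝ))‖ = 1 := by
    rw [mul_comm]
    exact Complex.norm_exp_ofReal_mul_I _
  have h3 : F - Complex.exp (Complex.I * (-Complex.arg m : ℝ)) * (h * F) =
      Complex.exp (Complex.I * (-Complex.arg m : ℝ)) * ((E - h) * F) := by
    linear_combination (-F) * h1
  have h4 : ‖m - E‖ = |‖m‖ - 1| := by
    have : m - E = ((‖m‖ - 1 : ℝ) : ℂ) * E := by
      conv_lhs => rw [← Complex.norm_mul_exp_arg_mul_I m]
      push_cast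
      ring
    rw [this, norm_mul, hEn, mul_one, Complex.norm_real, Real.norm_eq_abs]
  have h5 : |‖m‖ - 1| ≤ ‖h - m‖ + |1 - ‖h‖| := by
    have h6 : |‖m‖ - ‖h‖| ≤ ‖h - m‖ := by
      rw [norm_sub_rev]
      exact abs_norm_sub_norm_le m h
    have h7 := abs_sub_le ‖m‖ ‖h‖ 1
    rw [abs_sub_comm 1 ‖h‖]
    linarith
  have h8 : ‖E - h‖ ≤ 2 * ‖h - m‖ + |1 - ‖h‖| := by
    have h9 : ‖E - h‖ ≤ ‖E - m‖ + ‖m - h‖ := norm_sub_le_norm_sub_add_norm_sub E m h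
    rw [norm_sub_rev E m, h4, norm_sub_rev m h] at h9
    linarith
  rw [h3, norm_mul, h2, one_mul, norm_mul, abs_mul, abs_of_nonneg (norm_nonneg F)]
  calc ‖E - h‖ * ‖F‖ ≤ (2 * ‖h - m‖ + |1 - ‖h‖|) * ‖F‖ := by gcongr
    _ = _ := by ring

/-- Two functions that are holomorphic up to the same positive weight agree on an annulus, up to
a phase, when their moduli do. -/
theorem exists_eLpNorm_annulus_le {c : ℂ} {r R δ Δ : ℝ} {U : Set ℂ} {w : ℂ → ℝ}
    {F H P Q v : ℂ → ℂ} (hr : 0 ≤ r) (hR : 0 ≤ R) (hδ : 0 < δ) (hδΔ : δ ≤ Δ)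
    (hAU : Metric.ball c R \ Metric.closedBall c r ⊆ U)
    (hw : ContDiffOn ℝ 1 w (Metric.ball c R \ Metric.closedBall c r))
    (hP : DifferentiableOn ℂ P (Metric.ball c R \ Metric.closedBall c r))
    (hQ : DifferentiableOn ℂ Q (Metric.ball c R \ Metric.closedBall c r))
    (hF : EqOn F (fun z => (w z : ℂ) * P z) (Metric.ball c R \ Metric.closedBall c r))
    (hH : EqOn H (fun z => (w z : ℂ) * Q z) (Metric.ball c R \ Metric.closedBall c r))
    (hFδ : ∀ z ∈ Metric.ball c R \ Metric.closedBall c r, δ ≤ ‖F z‖)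
    (hFΔ : ∀ z ∈ Metric.ball c R \ Metric.closedBall c r, ‖F z‖ ≤ Δ)
    (hFgrad : ∀ z ∈ Metric.ball c R \ Metric.closedBall c r,
      DifferentiableAt ℝ (fun w => ‖F w‖) z → ‖fderiv ℝ (fun w => ‖F w‖) z‖ ≤ Δ)
    (hv : HasWeakGradient U (fun z => ‖F z‖ - ‖H z‖) v) :
    ∃ α : ℝ, eLpNorm (fun z => F z - Complex.exp (Complex.I * (α : ℂ)) * H z) 2
        (volume.restrict (Metric.ball c R \ Metric.closedBall c r)) ≤
      ENNReal.ofReal (Δ ^ 2 / δ ^ 2 * (1 + 4 * Real.pi * R)) *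
        (eLpNorm (fun z => ‖F z‖ - ‖H z‖) 2 (volume.restrict U) +
          eLpNorm v 2 (volume.restrict U)) := by
  set A := Metric.ball c R \ Metric.closedBall c r
  have hA : IsOpen A := Metric.isOpen_ball.sdiff Metric.isClosed_closedBall
  set u : ℂ → ℝ := fun z => ‖F z‖ - ‖H z‖ with hudef
  set h : ℂ → ℂ := fun z => Q z / P z with hh
  have hΔ : 0 < Δ := hδ.trans_le hδΔ
  have hF0 : ∀ z ∈ A, F z ≠ 0 := fun z hz => norm_pos_iff.1 (hδ.trans_le (hFδ z hz))
  have hP0 : ∀ z ∈ A, P z ≠ 0 := fun z hz hz0 => hF0 z hz (by rw [hF hz]; simp [hz0])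
  have hhd : DifferentiableOn ℂ h A := hQ.div hP hP0
  have hHF : ∀ z ∈ A, H z = h z * F z := by
    intro z hz
    rw [hF hz, hH hz, hh]
    have := hP0 z hz
    field_simp
  have hu : ∀ z ∈ A, u z = ‖F z‖ * (1 - ‖h z‖) := by
    intro z hz
    rw [hudef]
    simp only
    rw [hHF z hz, norm_mul]
    ring
  have hwC : ContDiffOn ℝ 1 (fun z => (w z : ℂ)) A :=
    Complex.ofRealCLM.contDiff.comp_contDiffOn hw
  have hFC : ContDiffOn ℝ 1 F A :=
    (hwC.mul ((hP.contDiffOn hA).restrict_scalars ℝ)).congr hF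
  have hHC : ContDiffOn ℝ 1 H A :=
    (hwC.mul ((hQ.contDiffOn hA).restrict_scalars ℝ)).congr hH
  -- The difference of the moduli is known to be `C¹` only away from the zeros of `H`; at almost
  -- every zero of `h` in `A` the derivative of `h` vanishes anyway.
  set A' := A ∩ h ⁻¹' {0}ᶜ
  have hA' : IsOpen A' := hhd.continuousOn.isOpen_inter_preimage hA isOpen_compl_singleton
  have hA'A : A' ⊆ A := inter_subset_left
  have huC : ContDiffOn ℝ 1 u A' := by
    refine ((hFC.mono hA'A).norm ℝ fun z hz => hF0 z hz.1).sub
      ((hHC.mono hA'A).norm ℝ fun z hz => ?_)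
    rw [hHF z hz.1]
    exact mul_ne_zero hz.2 (hF0 z hz.1)
  have hae : ∀ᵐ z ∂(volume.restrict A), ‖deriv h z‖ ≤ ‖(Δ / δ ^ 2) * (‖u z‖ + ‖v z‖)‖ := by
    rw [ae_restrict_iff' hA.measurableSet]
    filter_upwards [hv.ae_norm_fderiv_le hA' (hA'A.trans hAU) huC,
      ae_deriv_eq_zero_of_eq_zero hA hhd] with z h1 h2 hz
    rw [Real.norm_of_nonneg (by positivity)]
    by_cases h0 : h z = 0
    · rw [h2 hz h0, norm_zero]
      positivity
    · have hNd : DifferentiableAt ℝ (fun w => ‖F w‖) z :=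
        ((hFC.contDiffAt (hA.mem_nhds hz)).differentiableAt one_ne_zero).norm ℝ (hF0 z hz)
      refine (norm_deriv_div_le (u := u) hδ (hhd.differentiableAt (hA.mem_nhds hz)) h0 hNd
        ?_ (hFδ z hz) hδΔ (hFgrad z hz hNd)).trans ?_
      · filter_upwards [hA.mem_nhds hz] with w hw using hu w hw
      · rw [Real.norm_eq_abs]
        gcongr
        exact h1 ⟨hz, h0⟩
  have hum : AEStronglyMeasurable u (volume.restrict A) :=
    (hv.locallyIntegrableOn.mono_set hAU).aestronglyMeasurable
  have hvm : AEStronglyMeasurable v (volume.restrict A) :=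
    (hv.locallyIntegrableOn_grad.mono_set hAU).aestronglyMeasurable
  set N := eLpNorm u 2 (volume.restrict U) + eLpNorm v 2 (volume.restrict U) with hN
  have huN : eLpNorm u 2 (volume.restrict A) + eLpNorm v 2 (volume.restrict A) ≤ N :=
    add_le_add (eLpNorm_mono_measure _ (Measure.restrict_mono hAU le_rfl))
      (eLpNorm_mono_measure _ (Measure.restrict_mono hAU le_rfl))
  have hderiv : eLpNorm (deriv h) 2 (volume.restrict A) ≤ ENNReal.ofReal (Δ / δ ^ 2) * N := by
    refine (eLpNorm_mono_ae hae).trans ?_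
    have h1 := eLpNorm_const_smul (Δ / δ ^ 2) (fun z => ‖u z‖ + ‖v z‖) 2 (volume.restrict A)
    have h2 := eLpNorm_add_le hum.norm hvm.norm (p := 2) one_le_two
    rw [eLpNorm_norm, eLpNorm_norm] at h2
    calc _ = _ := h1
      _ ≤ ENNReal.ofReal (Δ / δ ^ 2) * N := by
        rw [Real.enorm_of_nonneg (by positivity)]
        gcongr
        exact h2.trans huN
  obtain ⟨m, hm⟩ := exists_lintegral_enorm_sub_sq_le hr hhd
  have hm' := eLpNorm_two_le_of_lintegral_sq_le (by positivity) hm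
  refine ⟨-Complex.arg m, ?_⟩
  have hpt : ∀ᵐ z ∂(volume.restrict A),
      ‖F z - Complex.exp (Complex.I * (-Complex.arg m : ℝ)) * H z‖ ≤
        ‖(2 * Δ) * ‖h z - m‖ + ‖u z‖‖ := by
    refine (ae_restrict_iff' hA.measurableSet).2 (Filter.Eventually.of_forall fun z hz => ?_)
    rw [Real.norm_of_nonneg (by positivity), hHF z hz, hu z hz, Real.norm_eq_abs]
    refine (norm_sub_exp_mul_le (F z) (h z) m).trans ?_
    gcongr
    exact hFΔ z hz
  have hhm : AEStronglyMeasurable (fun z => h z - m) (volume.restrict A) :=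
    (hhd.continuousOn.sub continuousOn_const).aestronglyMeasurable hA.measurableSet
  refine (eLpNorm_mono_ae hpt).trans ?_
  have h3 := eLpNorm_add_le (hhm.norm.const_mul (2 * Δ)) hum.norm (p := 2) one_le_two
  have h4 := eLpNorm_const_smul (2 * Δ) (fun z => ‖h z - m‖) 2 (volume.restrict A)
  rw [Real.enorm_of_nonneg (by positivity), eLpNorm_norm] at h4
  rw [eLpNorm_norm] at h3
  refine h3.trans ?_
  calc _ ≤ ENNReal.ofReal (2 * Δ) * (ENNReal.ofReal (2 * Real.pi * R) *
        (ENNReal.ofReal (Δ / δ ^ 2) * N)) + N := by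
        refine add_le_add ?_ (le_self_add.trans huN)
        refine h4.le.trans ?_
        gcongr
        refine hm'.trans ?_
        gcongr
    _ = ENNReal.ofReal (2 * Δ * (2 * Real.pi * R) * (Δ / δ ^ 2) + 1) * N := by
        rw [← mul_assoc, ← mul_assoc, ← ENNReal.ofReal_mul (by positivity),
          ← ENNReal.ofReal_mul (by positivity), ENNReal.ofReal_add (by positivity) zero_le_one,
          ENNReal.ofReal_one, add_mul, one_mul]
    _ ≤ _ := by
        gcongr
        -- This lets the term `|u|`, which has coefficient 1, be absorbed into the common factor.
        have h5 : 1 ≤ Δ ^ 2 / δ ^ 2 := by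
          rw [one_le_div (by positivity)]
          gcongr
        calc _ = Δ ^ 2 / δ ^ 2 * (4 * Real.pi * R) + 1 := by ring
          _ ≤ _ := by linarith

/-- The weight `y ^ (s + 1/2)` enters the squared norm as `y ^ (2 s + 1)`; the square root of the
resulting constant is the lagoon factor times `√(τ / (1 - τ))`, where `τ = r / R`. -/
theorem eLpNorm_closedBall_le_annulus {F K : ℂ → ℂ} {c : ℂ} {r R : ℝ} (s : ℕ) (hr : 0 ≤ r)
    (hrR : r < R) (hRc : R ≤ c.im) (hK : DifferentiableOn ℂ K (Metric.ball c R))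
    (hF : EqOn F (fun z => ((√z.im * z.im ^ s : ℝ) : ℂ) * K z) (Metric.ball c R)) :
    eLpNorm F 2 (volume.restrict (Metric.closedBall c r)) ≤
      ENNReal.ofReal (√(r / R / (1 - r / R)) * lagoonFactor s r c.im) *
        eLpNorm F 2 (volume.restrict (Metric.ball c R \ Metric.closedBall c r)) := by
  rcases hr.eq_or_lt with rfl | hr
  · rw [Metric.closedBall_zero]
    simp
  have hR : 0 < R := hr.trans hrR
  have hy : 0 < c.im := hR.trans_le hRc
  have hτ : 0 < 1 - r / R := by
    have := (div_lt_one hR).2 hrR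
    linarith
  have hτ' : 0 < 1 - r / c.im := by
    have := (div_lt_one hy).2 (hrR.trans_le hRc)
    linarith
  have him : ∀ z ∈ Metric.ball c R, 0 < z.im := by
    intro z hz
    rw [Metric.mem_ball, dist_eq_norm] at hz
    have h1 := (abs_le.1 (Complex.abs_im_le_norm (z - c))).1
    rw [Complex.sub_im] at h1
    linarith
  have hnorm : ∀ z ∈ Metric.ball c R,
      ‖F z‖ₑ ^ 2 = ENNReal.ofReal (z.im ^ (2 * s + 1) * ‖K z‖ ^ 2) := by
    intro z hz
    have hz' := him z hz
    rw [← ofReal_norm, ← ENNReal.ofReal_pow (norm_nonneg _), hF hz, norm_mul, Complex.norm_real,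
      Real.norm_of_nonneg (by positivity), mul_pow, mul_pow, Real.sq_sqrt hz'.le]
    congr 2
    ring
  have hsq : (√(r / R / (1 - r / R)) * lagoonFactor s r c.im) ^ 2 =
      r / R / (1 - r / R) * (1 / (1 - r / c.im)) ^ (2 * s + 1) := by
    rw [mul_pow, Real.sq_sqrt (by positivity), lagoonFactor, abs_of_pos (by positivity),
      ← Real.rpow_natCast, ← Real.rpow_natCast, ← Real.rpow_mul (by positivity)]
    congr 2
    push_cast
    ring
  refine eLpNorm_two_le_of_lintegral_sq_le
    (mul_nonneg (Real.sqrt_nonneg _) (Real.rpow_nonneg (abs_nonneg _) _)) ?_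
  rw [hsq, setLIntegral_congr_fun Metric.isClosed_closedBall.measurableSet
    (fun z hz => hnorm z (Metric.closedBall_subset_ball hrR hz)),
    setLIntegral_congr_fun (Metric.isOpen_ball.sdiff Metric.isClosed_closedBall).measurableSet
    (fun z hz => hnorm z hz.1)]
  exact setLIntegral_weighted_closedBall_le_annulus (2 * s + 1) hr hrR hRc hK

theorem radius_le_im_of_ball_subset {c : ℂ} {R : ℝ} (hR : 0 < R)
    (h : Metric.ball c R ⊆ upperHalf) : R ≤ c.im := by
  have hc : 0 < c.im := h (Metric.mem_ball_self hR)
  by_contra hlt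
  rw [not_le] at hlt
  have h1 : c - c.im * Complex.I ∈ Metric.ball c R := by
    simpa [Metric.mem_ball, dist_eq_norm, abs_of_pos hc] using hlt
  have h2 : 0 < (c - c.im * Complex.I).im := h h1
  simp at h2

/-- This brings the lagoon constant into the form of the theorem with `ρ τ = 4 π / √(1 - τ)`: the `4
π` serves the Poincaré constant and the root serves the lagoon. Only the term `1 / √R` of the sum is
used. -/
theorem one_add_sqrt_mul_le {r R L : ℝ} (hr : 0 ≤ r) (hrR : r < R) (hL : 0 ≤ L) :
    1 + √(r / R / (1 - r / R)) * L ≤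
      1 + √r * (4 * Real.pi / √(1 - r / R)) * (√R + 1 / √R) * L := by
  have hR : 0 < R := hr.trans_lt hrR
  have hτ : 0 < 1 - r / R := by
    have := (div_lt_one hR).2 hrR
    linarith
  have hpi : 1 ≤ 4 * Real.pi := by linarith [Real.pi_gt_three]
  gcongr
  rw [Real.sqrt_div (by positivity), Real.sqrt_div hr]
  calc √r / √R / √(1 - r / R) = √r * (1 / √(1 - r / R)) * (0 + 1 / √R) := by ring
    _ ≤ _ := by gcongr; positivity

/-- The stability estimate on a single atoll, in terms of a weak gradient of the difference of
the moduli. -/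
theorem exists_eLpNorm_ball_le (s : ℕ) {c : ℂ} {r R δ Δ : ℝ} {U : Set ℂ} {v : ℂ → ℂ}
    (f g : Lp ℂ 2 (volume : Measure ℝ)) (hr : 0 ≤ r) (hrR : r < R)
    (hD : Metric.ball c R ⊆ upperHalf) (hδ : 0 < δ) (hδΔ : δ ≤ Δ)
    (hf : IsAtollFunction (Metric.ball c R) (fun _ : Unit => Metric.ball c r) δ Δ
      (waveletTransform (cauchyWavelet s) f))
    (hU : atollDomain (Metric.ball c R) (fun _ : Unit => Metric.ball c r) ⊆ U)
    (hv : HasWeakGradient U (fun w => ‖waveletTransform (cauchyWavelet s) f w‖ -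
      ‖waveletTransform (cauchyWavelet s) g w‖) v) :
    ∃ α : ℝ, eLpNorm (fun w => waveletTransform (cauchyWavelet s) f w -
        Complex.exp (Complex.I * (α : ℂ)) * waveletTransform (cauchyWavelet s) g w)
        2 (volume.restrict (Metric.ball c R)) ≤
      ENNReal.ofReal (Δ ^ 2 / δ ^ 2 * (1 + 4 * Real.pi / √(1 - r / R) * R) *
        (1 + √r * (4 * Real.pi / √(1 - r / R)) * (√R + 1 / √R) * lagoonFactor s r c.im)) *
        (eLpNorm (fun w => ‖waveletTransform (cauchyWavelet s) f w‖ -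
          ‖waveletTransform (cauchyWavelet s) g w‖) 2 (volume.restrict U) +
          eLpNorm v 2 (volume.restrict U)) := by
  set F := waveletTransform (cauchyWavelet s) f with hFdef
  set H := waveletTransform (cauchyWavelet s) g with hHdef
  set A := Metric.ball c R \ Metric.closedBall c r with hAdef
  have hR : 0 < R := hr.trans_lt hrR
  have hτ : 0 < 1 - r / R := by
    have := (div_lt_one hR).2 hrR
    linarith
  have hRc := radius_le_im_of_ball_subset hR hD
  -- Equality fails for `r = 0`: the closed ball is then the point `c`, while the closure of the
  -- open ball is empty.
  have hAD : A ⊆ atollDomain (Metric.ball c R) (fun _ : Unit => Metric.ball c r) := by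
    rintro z ⟨hz1, hz2⟩
    refine ⟨hz1, fun hz => hz2 ?_⟩
    rw [iUnion_const] at hz
    exact Metric.closure_ball_subset_closedBall hz
  have hAball : A ⊆ Metric.ball c R := sdiff_subset
  have hP := (differentiableOn_cauchyTransform s f).mono hD
  have hQ := (differentiableOn_cauchyTransform s g).mono hD
  have hF : EqOn F (fun z => ((√z.im * z.im ^ s : ℝ) : ℂ) * cauchyTransform s f z)
      (Metric.ball c R) := fun z hz => waveletTransform_cauchyWavelet s f (hD hz)
  have hH : EqOn H (fun z => ((√z.im * z.im ^ s : ℝ) : ℂ) * cauchyTransform s g z)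
      (Metric.ball c R) := fun z hz => waveletTransform_cauchyWavelet s g (hD hz)
  have him : ContDiff ℝ 1 (fun z : ℂ => z.im) := Complex.imCLM.contDiff
  have hw : ContDiffOn ℝ 1 (fun z : ℂ => √z.im * z.im ^ s) A := by
    refine ContDiffOn.mul (him.contDiffOn.sqrt fun z hz => ?_) (him.pow s).contDiffOn
    have : 0 < z.im := hD (hAball hz)
    exact this.ne'
  obtain ⟨α, hα⟩ := exists_eLpNorm_annulus_le hr hR.le hδ hδΔ (hAD.trans hU) hw (hP.mono hAball)
    (hQ.mono hAball) (hF.mono hAball) (hH.mono hAball) (fun z hz => hf.le_norm z (hAD hz))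
    (fun z hz => hf.norm_le z (hAball hz)) (fun z hz => hf.grad_le z (hAball hz)) hv
  refine ⟨α, ?_⟩
  set G : ℂ → ℂ := fun w => F w - Complex.exp (Complex.I * (α : ℂ)) * H w with hG
  set N := eLpNorm (fun w => ‖F w‖ - ‖H w‖) 2 (volume.restrict U) + eLpNorm v 2 (volume.restrict U)
  have hGeq : EqOn G (fun z => ((√z.im * z.im ^ s : ℝ) : ℂ) * (cauchyTransform s f z -
      Complex.exp (Complex.I * (α : ℂ)) * cauchyTransform s g z)) (Metric.ball c R) := by
    intro z hz
    rw [hG]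
    simp only
    rw [hF hz, hH hz]
    ring
  -- The phase found on the annulus is kept on the lagoon, since the difference is the weight times
  -- a holomorphic function on the whole disc.
  have hlag := eLpNorm_closedBall_le_annulus s hr hrR hRc (hP.sub (hQ.const_mul _)) hGeq
  have hL : 0 ≤ lagoonFactor s r c.im := Real.rpow_nonneg (abs_nonneg _) _
  have hball : Metric.ball c R = A ∪ Metric.closedBall c r :=
    (sdiff_union_of_subset (Metric.closedBall_subset_ball hrR)).symm
  have hsqrt : √(1 - r / R) ≤ 1 := Real.sqrt_le_one.2 (by
    have : 0 ≤ r / R := by positivity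
    linarith)
  calc eLpNorm G 2 (volume.restrict (Metric.ball c R))
      ≤ eLpNorm G 2 (volume.restrict A) + eLpNorm G 2 (volume.restrict (Metric.closedBall c r)) := by
        rw [hball]
        exact eLpNorm_two_restrict_union_le _ _ _ _
    _ ≤ ENNReal.ofReal (1 + √(r / R / (1 - r / R)) * lagoonFactor s r c.im) *
          eLpNorm G 2 (volume.restrict A) := by
        rw [ENNReal.ofReal_add zero_le_one (by positivity), ENNReal.ofReal_one, add_mul, one_mul]
        gcongr
    _ ≤ ENNReal.ofReal (1 + √(r / R / (1 - r / R)) * lagoonFactor s r c.im) *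
          (ENNReal.ofReal (Δ ^ 2 / δ ^ 2 * (1 + 4 * Real.pi * R)) * N) := by gcongr
    _ ≤ _ := by
        have hone : 4 * Real.pi ≤ 4 * Real.pi / √(1 - r / R) := by
          rw [le_div_iff₀ (by positivity)]
          exact mul_le_of_le_one_right (by positivity) hsqrt
        rw [← mul_assoc, ← ENNReal.ofReal_mul (by positivity),
          mul_comm (1 + √(r / R / (1 - r / R)) * lagoonFactor s r c.im)]
        gcongr ENNReal.ofReal ?_ * _
        refine mul_le_mul ?_ (one_add_sqrt_mul_le hr hrR hL) (by positivity) (by positivity)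
        gcongr

/-! ### The hyperbolic area of a disc -/

theorem volume_real_reProdIm_Icc {a b a' b' : ℝ} (h : a ≤ b) (h' : a' ≤ b') :
    volume.real (Icc a b ×ℂ Icc a' b') = (b - a) * (b' - a') := by
  have hpre : Icc a b ×ℂ Icc a' b' = Complex.measurableEquivRealProd ⁻¹' (Icc a b ×ˢ Icc a' b') := rfl
  rw [hpre, measureReal_def, Complex.volume_preserving_equiv_real_prod.measure_preimage
    (measurableSet_Icc.prod measurableSet_Icc).nullMeasurableSet, Measure.volume_eq_prod,
    Measure.prod_prod, Real.volume_Icc, Real.volume_Icc, ENNReal.toReal_mul,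
    ENNReal.toReal_ofReal (by linarith), ENNReal.toReal_ofReal (by linarith)]

/-- With `η = Im z - r` the height of the lowest point, the disc contains a rectangle of width `2
√(r η)` at heights from `2 η` to `3 η`. There `1 / y² ≥ 1 / (9 η²)`, which gives `2 √(r η) η / (9
η²)`. The hypothesis `2 η < r` keeps the rectangle inside the disc. -/
theorem hyperbolicArea_ball_ge {z : ℂ} {r : ℝ} (hr : 2 * (z.im - r) < r) (hrz : r < z.im) :
    2 / 9 * √(r / (z.im - r)) ≤ hyperbolicArea (Metric.ball z r) := by
  set η := z.im - r with hη
  have hη0 : 0 < η := by linarith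
  have hr0 : 0 < r := by linarith
  set a := √(r * η) with ha
  have ha0 : 0 ≤ a := Real.sqrt_nonneg _
  have ha2 : a ^ 2 = r * η := Real.sq_sqrt (by positivity)
  set S := Icc (z.re - a) (z.re + a) ×ℂ Icc (2 * η) (3 * η) with hS
  have hSball : S ⊆ Metric.ball z r := by
    rintro w ⟨⟨hw1, hw2⟩, hw3, hw4⟩
    rw [Metric.mem_ball, dist_eq_norm, ← abs_of_pos hr0, ← abs_norm, ← sq_lt_sq,
      ← Complex.normSq_eq_norm_sq, Complex.normSq_apply, Complex.sub_re, Complex.sub_im]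
    have h1 : (w.re - z.re) * (w.re - z.re) ≤ r * η := by
      rw [← ha2]
      nlinarith
    have h2 : z.im = r + η := by rw [hη]; ring
    rw [h2]
    nlinarith [mul_nonneg (sub_nonneg.2 hw3) hr0.le,
      mul_pos (show 0 < w.im - η by linarith) (show 0 < r - (w.im - η) by linarith)]
  have hSm : MeasurableSet S := (isClosed_Icc.reProdIm isClosed_Icc).measurableSet
  have hcont : ContinuousOn (fun w : ℂ => 1 / w.im ^ 2) (Metric.closedBall z r) := by
    refine continuousOn_const.div (by fun_prop) fun w hw => ?_
    rw [Metric.mem_closedBall, dist_eq_norm] at hw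
    have h1 := (abs_le.1 (Complex.abs_im_le_norm (w - z))).1
    rw [Complex.sub_im] at h1
    have : 0 < w.im := by linarith
    positivity
  have hint : IntegrableOn (fun w : ℂ => 1 / w.im ^ 2) (Metric.ball z r) :=
    (hcont.integrableOn_compact (isCompact_closedBall _ _)).mono_set Metric.ball_subset_closedBall
  have hSfin : volume S ≠ ⊤ := ((measure_mono hSball).trans_lt measure_ball_lt_top).ne
  have hconst : ∫ _ in S, 1 / (3 * η) ^ 2 = 2 / 9 * √(r / η) := by
    rw [setIntegral_const, volume_real_reProdIm_Icc (by linarith) (by linarith), smul_eq_mul]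
    have h1 : √(r / η) = a / η := by
      rw [ha, show r / η = r * η / η ^ 2 by field_simp, Real.sqrt_div (by positivity),
        Real.sqrt_sq hη0.le]
    rw [h1]
    field_simp
    ring
  rw [← hconst]
  calc ∫ _ in S, 1 / (3 * η) ^ 2 ≤ ∫ w in S, 1 / w.im ^ 2 := by
        refine setIntegral_mono_on (integrableOn_const hSfin) (hint.mono_set hSball) hSm ?_
        rintro w ⟨_, hw3, hw4⟩
        have : 0 < w.im := by linarith
        gcongr
    _ ≤ _ := setIntegral_mono_set hint (Filter.Eventually.of_forall fun w => by positivity)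
        hSball.eventuallyLE

/-- The left side equals `1 + r / η` with `η = Im z - r`. If `r > 2 η`, the area bound gives `r / η
≤ (81 / 4) A²`; otherwise the left side is at most 3. The constant `6² = 36` covers both cases. -/
theorem one_div_one_sub_le_hyperbolicArea {z : ℂ} {r : ℝ} (hr : 0 ≤ r) (hrz : r < z.im) :
    1 / (1 - r / z.im) ≤ (6 * (1 + hyperbolicArea (Metric.ball z r))) ^ 2 := by
  have hy : 0 < z.im := hr.trans_lt hrz
  have hA : 0 ≤ hyperbolicArea (Metric.ball z r) := integral_nonneg fun w => by positivity
  have hη : 0 < z.im - r := by linarith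
  have hT : 1 / (1 - r / z.im) = 1 + r / (z.im - r) := by
    have : 1 - r / z.im ≠ 0 := by
      rw [one_sub_div hy.ne']
      exact (div_pos hη hy).ne'
    field_simp
    ring
  rw [hT]
  set A := hyperbolicArea (Metric.ball z r)
  rcases lt_or_ge (2 * (z.im - r)) r with h | h
  · have h1 := hyperbolicArea_ball_ge h hrz
    have h2 : (2 / 9 * √(r / (z.im - r))) ^ 2 ≤ A ^ 2 := by gcongr
    rw [mul_pow, Real.sq_sqrt (by positivity)] at h2
    nlinarith
  · have h1 : r / (z.im - r) ≤ 2 := by rwa [div_le_iff₀ hη]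
    nlinarith

theorem lagoonFactor_le_hyperbolicArea (s : ℕ) {z : ℂ} {r : ℝ} (hr : 0 ≤ r) (hrz : r < z.im) :
    lagoonFactor s r z.im ≤
      6 ^ (2 * s + 1) * (1 + hyperbolicArea (Metric.ball z r)) ^ (2 * s + 1) := by
  have hA : 0 ≤ hyperbolicArea (Metric.ball z r) := integral_nonneg fun w => by positivity
  have hpos : 0 < 1 - r / z.im := by
    have := (div_lt_one (hr.trans_lt hrz)).2 hrz
    linarith
  rw [lagoonFactor, abs_of_pos (by positivity), ← mul_pow]
  calc _ ≤ ((6 * (1 + hyperbolicArea (Metric.ball z r))) ^ 2) ^ ((s : ℝ) + 1 / 2) := by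
        gcongr
        exact one_div_one_sub_le_hyperbolicArea hr hrz
    _ = _ := by
        rw [← Real.rpow_natCast, ← Real.rpow_natCast, ← Real.rpow_mul (by positivity)]
        congr 1
        push_cast
        ring

/-- The function of the relative lagoon radius in the stability constant. -/
noncomputable def stabilityFactor (τ : ℝ) : ℝ := 4 * Real.pi / √(1 - τ)

theorem continuousOn_stabilityFactor : ContinuousOn stabilityFactor (Ico 0 1) := by
  refine continuousOn_const.div (by fun_prop) fun τ hτ => ?_
  exact (Real.sqrt_pos.2 (sub_pos.2 hτ.2)).ne'

theorem stabilityFactor_pos {τ : ℝ} (hτ : τ < 1) : 0 < stabilityFactor τ :=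
  div_pos (by positivity) (Real.sqrt_pos.2 (sub_pos.2 hτ))

theorem mainTheorem4 :
    -- the stability estimate, with uniform `ρ` and `c`
    (∃ ρ : ℝ → ℝ, ContinuousOn ρ (Ico 0 1) ∧ (∀ τ ∈ Ico (0 : ℝ) 1, 0 < ρ τ) ∧
      ∃ c : ℝ, 0 < c ∧
      ∀ (s k : ℕ) (z : Fin k → ℂ) (r R δ Δ : Fin k → ℝ),
        (∀ j, 0 ≤ r j) → (∀ j, r j < R j) → (∀ j, Metric.ball (z j) (R j) ⊆ upperHalf) →
        (∀ j, 0 < δ j) → (∀ j, δ j ≤ Δ j) →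
      ∀ f : Lp ℂ 2 (volume : Measure ℝ), IsAnalyticSignal f →
        (∀ j, IsAtollFunction (Metric.ball (z j) (R j))
          (fun _ : Unit => Metric.ball (z j) (r j)) (δ j) (Δ j)
          (waveletTransform (cauchyWavelet s) f)) →
      ∀ g : Lp ℂ 2 (volume : Measure ℝ), IsAnalyticSignal g →
        (⨅ α : Fin k → ℝ, ∑ j, eLpNorm
            (fun w => waveletTransform (cauchyWavelet s) f w -
              Complex.exp (Complex.I * (α j : ℂ)) * waveletTransform (cauchyWavelet s) g w)
            2 (volume.restrict (Metric.ball (z j) (R j))))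
          ≤ ENNReal.ofReal (c * ∑ j, (Δ j) ^ 2 / (δ j) ^ 2 * (1 + ρ (r j / R j) * R j) *
              (1 + √(r j) * ρ (r j / R j) * (√(R j) + 1 / √(R j)) *
                lagoonFactor s (r j) (z j).im)) *
            sobolevNorm
              (⋃ j, atollDomain (Metric.ball (z j) (R j))
                (fun _ : Unit => Metric.ball (z j) (r j)))
              (fun w => ‖waveletTransform (cauchyWavelet s) f w‖ -
                ‖waveletTransform (cauchyWavelet s) g w‖)) ∧
    -- the lagoon factor is at most polynomial in the hyperbolic area of the lagoon
    (∀ s : ℕ, ∃ C : ℝ, 0 < C ∧ ∀ (z : ℂ) (r : ℝ), 0 ≤ r → r < z.im →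
      lagoonFactor s r z.im ≤ C * (1 + hyperbolicArea (Metric.ball z r)) ^ (2 * s + 1)) := by
  refine ⟨⟨stabilityFactor, continuousOn_stabilityFactor, fun τ hτ => stabilityFactor_pos hτ.2,
    1, one_pos, ?_⟩, fun s => ⟨6 ^ (2 * s + 1), by positivity,
      fun z r hr hrz => lagoonFactor_le_hyperbolicArea s hr hrz⟩⟩
  intro s k z r R δ Δ hr hrR hD hδ hδΔ f _ hf g _
  set C : Fin k → ℝ := fun j => (Δ j) ^ 2 / (δ j) ^ 2 * (1 + stabilityFactor (r j / R j) * R j) *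
    (1 + √(r j) * stabilityFactor (r j / R j) * (√(R j) + 1 / √(R j)) *
      lagoonFactor s (r j) (z j).im) with hC
  have hCpos : ∀ j, 0 < C j := by
    intro j
    have hR : 0 < R j := (hr j).trans_lt (hrR j)
    have hΔ : 0 < Δ j := (hδ j).trans_le (hδΔ j)
    have h1 := hδ j
    have h2 := stabilityFactor_pos ((div_lt_one hR).2 (hrR j))
    have h3 : 0 ≤ lagoonFactor s (r j) (z j).im := Real.rpow_nonneg (abs_nonneg _) _
    positivity
  rw [one_mul]
  -- Moving the constant inside the infimum over weak gradients requires it to be nonzero, which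
  -- fails for the empty sum.
  rcases Nat.eq_zero_or_pos k with rfl | hk
  · simp
  have hsum : ENNReal.ofReal (∑ j, C j) ≠ 0 := by
    rw [Ne, ENNReal.ofReal_eq_zero, not_le]
    exact Finset.sum_pos (fun j _ => hCpos j) ⟨⟨0, hk⟩, Finset.mem_univ _⟩
  rw [sobolevNorm, ENNReal.mul_iInf_of_ne hsum ENNReal.ofReal_ne_top]
  refine le_iInf fun v => ?_
  rw [ENNReal.mul_iInf_of_ne hsum ENNReal.ofReal_ne_top]
  refine le_iInf fun hv => ?_
  -- One weak gradient on the union serves every atoll, so the right sides share the Sobolev factor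
  -- and only the constants are summed.
  have hone := fun j => exists_eLpNorm_ball_le s f g (hr j) (hrR j) (hD j) (hδ j) (hδΔ j) (hf j)
    (subset_iUnion (fun j => atollDomain (Metric.ball (z j) (R j))
      (fun _ : Unit => Metric.ball (z j) (r j))) j) hv
  choose α hα using hone
  refine (iInf_le _ α).trans ((Finset.sum_le_sum fun j _ => hα j).trans ?_)
  rw [← Finset.sum_mul, ENNReal.ofReal_sum_of_nonneg fun j _ => (hCpos j).le]
  exact le_rfl
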